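/- Let $d\ge 0$ and $k\ge 0$ be integers. A realization of a finite simple graph $G=(V,E)$ in $\mathbb R^d$ (or $\mathbb C^d$) is a map $p\colon V\to\mathbb R^d$ (or $\mathbb C^d$); it is generic if its coordinates are algebraically independent over $\mathbb Q$. The graph $G$ is $d$-rigid if for every generic $\rho\colon V\to\mathbb R^d$ there is $\varepsilon>0$ such that every $\rho'\colon V\to\mathbb R^d$ with the same edge lengths as $\rho$ and with $\|\rho(v)-\rho'(v)\|<\varepsilon$ for all $v\in V$ satisfies $\|\rho'(u)-\rho'(v)\|=\|\rho(u)-\rho(v)\|$ for all $u,v\in V$; it is minimally $d$-rigid if moreover deleting any edge yields a graph that is not $d$-rigid. For $x\in\mathbb C^d$ put $\|x\|^2=\sum_{i=1}^d x_i^2$. The number of complex realizations $c_d(G)$ is the number of realizations $q\colon V\to\mathbb C^d$ with $\|q(u)-q(v)\|^2=\|p(u)-p(v)\|^2$ for all edges $uv\in E$, where $p\colon V\to\mathbb C^d$ is generic, counted up to direct isometries $x\mapsto Ax+b$ with $A\in SO(d,\mathbb C)$, $b\in\mathbb C^d$ (so mirror images are counted separately). Theorem. Let $G'$ be a finite minimally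 $d$-rigid graph, let $H$ be a minimally $d$-rigid subgraph of $G'$ with at least $d$ vertices, and let $G$ be the graph obtained by gluing $k$ copies of $G'$ along $H$, that is, by identifying the $k$ copies of $H$ (for $k=0$ this is $H$). Then $c_d(H)$, $c_d(G')$ and $c_d(G)$ are well defined (finite and independent of the choice of the generic $p$), $c_d(H)>0$, and $$c_d(G)=c_d(H)\cdot\left(\frac{c_d(G')}{c_d(H)}\right)^{k}.$$ -/

import Mathlib

namespace RigidCount

/-- A configuration `p : V → K^d` is generic if all its coordinates are algebraically independent
over the rationals. -/
def IsGeneric {V K : Type*} [Field K] [Algebra ℚ K] {d : ℕ} (p : V → Fin d → K) : Prop :=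
  AlgebraicIndependent ℚ (fun x : V × Fin d => p x.1 x.2)

/-! ### Rigidity in Euclidean space -/

/-- A graph is (generically) `d`-rigid if for every generic realization `ρ` in `ℝ^d` every
equivalent realization (same edge lengths) close enough to `ρ` is congruent to `ρ`
(same distances between all pairs of vertices). -/
def IsRigid {V : Type*} (d : ℕ) (G : SimpleGraph V) : Prop :=
  ∀ ρ : V → EuclideanSpace ℝ (Fin d), IsGeneric (fun v i => ρ v i) →
    ∃ ε : ℝ, 0 < ε ∧ ∀ ρ' : V → EuclideanSpace ℝ (Fin d),
      (∀ u v, G.Adj u v → ‖ρ' u - ρ' v‖ = ‖ρ u - ρ v‖) →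
      (∀ v, ‖ρ v - ρ' v‖ < ε) →
      ∀ u v, ‖ρ' u - ρ' v‖ = ‖ρ u - ρ v‖

/-- A graph is minimally `d`-rigid if it is `d`-rigid and deleting any edge destroys this. -/
def IsMinimallyRigid {V : Type*} (d : ℕ) (G : SimpleGraph V) : Prop :=
  IsRigid d G ∧ ∀ e ∈ G.edgeSet, ¬ IsRigid d (G.deleteEdges {e})

/-! ### Counting complex realizations -/

/-- The complex bilinear extension of the squared Euclidean norm (no complex conjugation). -/
def sqNorm {d : ℕ} (x : Fin d → ℂ) : ℂ := ∑ i, x i ^ 2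

/-- Two complex realizations are equivalent if all edges have the same (squared) lengths. -/
def Equivalent {V : Type*} {d : ℕ} (G : SimpleGraph V) (p q : V → Fin d → ℂ) : Prop :=
  ∀ u v, G.Adj u v → sqNorm (q u - q v) = sqNorm (p u - p v)

open Matrix in
/-- Two complex realizations are directly congruent if they differ by a direct isometry of `ℂ^d`,
that is a rotation in `SO(d, ℂ)` followed by a translation. Reflections are not allowed. -/
def DirectlyCongruent {V : Type*} {d : ℕ} (p q : V → Fin d → ℂ) : Prop :=
  ∃ (A : Matrix (Fin d) (Fin d) ℂ) (b : Fin d → ℂ),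
    Aᵀ * A = 1 ∧ A.det = 1 ∧ ∀ v, q v = A *ᵥ p v + b

open Matrix in
/-- Direct congruence as an equivalence relation on the realizations equivalent to `p`. -/
def congruenceSetoid {V : Type*} {d : ℕ} (G : SimpleGraph V) (p : V → Fin d → ℂ) :
    Setoid {q : V → Fin d → ℂ // Equivalent G p q} where
  r q q' := DirectlyCongruent q.1 q'.1
  iseqv :=
    { refl := fun q => ⟨1, 0, by simp, by simp, by simp⟩
      symm := by
        rintro q q' ⟨A, b, hA, hdet, h⟩
        refine ⟨Aᵀ, -(Aᵀ *ᵥ b), ?_, by simpa using hdet, fun v => ?_⟩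
        · simpa using mul_eq_one_comm.mp hA
        · rw [h v, mulVec_add, mulVec_mulVec, hA, one_mulVec]
          abel
      trans := by
        rintro q q' q'' ⟨A, b, hA, hdet, h⟩ ⟨B, c, hB, hdet', h'⟩
        refine ⟨B * A, B *ᵥ b + c, ?_, by simp [hdet, hdet'], fun v => ?_⟩
        · rw [transpose_mul, Matrix.mul_assoc, ← Matrix.mul_assoc Bᵀ, hB, Matrix.one_mul, hA]
        · rw [h' v, h v, mulVec_add, mulVec_mulVec]
          abel }

/-- The number (possibly infinite) of complex realizations equivalent to `p`, up to direct
isometries. -/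
noncomputable def numRealizations {V : Type*} {d : ℕ} (G : SimpleGraph V)
    (p : V → Fin d → ℂ) : ℕ∞ :=
  ENat.card (Quotient (congruenceSetoid G p))

/-- `N` is the common finite number of complex realizations, up to direct isometries, of
all generic complex frameworks on `G`. -/
def IsRealizationCount {V : Type*} (d : ℕ) (G : SimpleGraph V) (N : ℕ) : Prop :=
  ∀ p : V → Fin d → ℂ, IsGeneric p → numRealizations G p = N

/-- Generic complex configurations exist for finite vertex sets. -/
theorem exists_isGeneric (V : Type*) [Finite V] (d : ℕ) :
    ∃ p : V → Fin d → ℂ, IsGeneric p := by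
  obtain ⟨s, hs⟩ := exists_isTranscendenceBasis ℚ ℂ
  have hcard := IsAlgClosed.cardinal_eq_cardinal_transcendence_basis_of_aleph0_lt
    _ hs (by simp) (by simpa using Cardinal.aleph0_lt_continuum)
  have hs' : Infinite s := by
    rw [Cardinal.infinite_iff]
    have h : Cardinal.mk ℂ = Cardinal.mk s := by simpa using hcard
    rw [← h]
    simpa using Cardinal.aleph0_le_continuum
  obtain ⟨n, ⟨e⟩⟩ := Finite.exists_equiv_fin (V × Fin d)
  let f : V × Fin d ↪ s := e.toEmbedding.trans (Fin.valEmbedding.trans (Infinite.natEmbedding s))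
  exact ⟨fun v i => (f (v, i) : ℂ), hs.1.comp f f.injective⟩

/-- The realization count of a graph is unique if it exists. -/
theorem IsRealizationCount.unique {V : Type*} [Finite V] {d : ℕ} {G : SimpleGraph V} {M N : ℕ}
    (hM : IsRealizationCount d G M) (hN : IsRealizationCount d G N) : M = N := by
  obtain ⟨p, hp⟩ := exists_isGeneric V d
  exact_mod_cast (hM p hp).symm.trans (hN p hp)

open Classical in
/-- The number `c_d(G)` of complex realizations of `G` in `ℂ^d` up to direct isometries, that is
the unique `N` with `IsRealizationCount d G N` (and `0` if there is none). -/
noncomputable def realizationCount {V : Type*} (d : ℕ) (G : SimpleGraph V) : ℕ :=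
  if h : ∃ N, IsRealizationCount d G N then h.choose else 0

/-- If all generic frameworks on `G` have `N` realizations, then `c_d(G) = N`. -/
theorem IsRealizationCount.realizationCount_eq {V : Type*} [Finite V] {d : ℕ}
    {G : SimpleGraph V} {N : ℕ} (hN : IsRealizationCount d G N) : realizationCount d G = N := by
  have h : ∃ N, IsRealizationCount d G N := ⟨N, hN⟩
  rw [realizationCount, dif_pos h]
  exact h.choose_spec.unique hN

/-! ### Gluing -/

/-- The vertices of the graph obtained by gluing `k` copies along `H`: the shared vertices of `H`
and, for each copy, the vertices outside `H`. -/
abbrev FanVertex {V : Type*} {G' : SimpleGraph V} (H : G'.Subgraph) (k : ℕ) : Type _ :=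
  H.verts ⊕ (Fin k × (H.vertsᶜ : Set V))

open Classical in
/-- The inclusion of the vertices of the `j`-th copy. -/
noncomputable def copyMap {V : Type*} {G' : SimpleGraph V} (H : G'.Subgraph) (k : ℕ) (j : Fin k)
    (v : V) : FanVertex H k :=
  if hv : v ∈ H.verts then Sum.inl ⟨v, hv⟩ else Sum.inr (j, ⟨v, hv⟩)

/-- The graph obtained by gluing `k` copies of `G'` along the subgraph `H`: the union of `H` and
of the `k` copies. -/
noncomputable def fan {V : Type*} (G' : SimpleGraph V) (H : G'.Subgraph) (k : ℕ) :
    SimpleGraph (FanVertex H k) :=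
  H.coe.map Sum.inl ⊔ ⨆ j : Fin k, G'.map (copyMap H k j)

end RigidCount

/-!
Restriction to `H` maps the classes of realizations equivalent to a generic realization of the glued
graph to those of `H`. The number of realizations is multiplicative because every class downstairs
has trivial stabilizer and the same number of extensions to each copy of `G'`.

The algebraic input is that the squared edge lengths of a minimally rigid graph are algebraically
independent polynomials (`IsMinimallyRigid.algebraicIndependent`) over which all squared distances
are algebraic (`IsMinimallyRigid.isAlgebraic_distPoly`). The first holds because an edge whose
length is algebraic over the others is locally determined by them, hence redundant. The second holds
because algebraically independent polynomials have a surjective Jacobian at generic points, so that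
a distance transcendental over the edge lengths could be varied on its own.

Consequently a realization equivalent to a generic one, although not generic itself, has distances
satisfying only the identical relations (`IsMinimallyRigid.eq_zero_of_evalAt_eq_zero`). In
particular, for `d > 0`, some `d` of its points affinely span a nondegenerate hyperplane, so that it
is determined by its distances up to `O(d, ℂ)` (`exists_congruence`) and has trivial stabilizer in
the group of direct isometries (`eq_one_and_eq_zero_of_fixes`). As each distance can take only
finitely many values, the number of classes is finite.

For the same reason any two realizations of `H` equivalent to restrictions of generic realizations
of `G'` have conjugate distances, by an automorphism of `ℂ` that also matches the lengths of the
remaining edges of `G'` (`exists_ringEquiv_of_equivalent`). Applying it, followed by an isometry,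
identifies their sets of extensions (`nonempty_extension_equiv`). Automorphisms of `ℂ` likewise show
that the counts do not depend on the choice of the generic realization.
-/

namespace RigidCount

/-! ### Extending isomorphisms to algebraically closed fields -/

open Algebra Cardinal in
/-- Two algebraically closed fields of the same uncountable cardinality that contain a countable
ring `R` are isomorphic over `R`, since their transcendence bases over `R` are equipotent. -/
theorem exists_ringEquiv_algebraMap {R : Type*} {K L : Type} [CommRing R] [Nontrivial R]
    [Countable R] [Field K] [IsAlgClosed K] [Algebra R K] [FaithfulSMul R K]
    [Field L] [IsAlgClosed L] [Algebra R L] [FaithfulSMul R L]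
    (hK : ℵ₀ < #K) (h : #K = #L) :
    ∃ σ : K ≃+* L, ∀ x : R, σ (algebraMap R K x) = algebraMap R L x := by
  obtain ⟨s, hs⟩ := exists_isTranscendenceBasis R K
  obtain ⟨t, ht⟩ := exists_isTranscendenceBasis R L
  have hR : #R ≤ ℵ₀ := mk_le_aleph0
  have h₁ := IsAlgClosed.cardinal_eq_cardinal_transcendence_basis_of_aleph0_lt _ hs hR hK
  have h₂ := IsAlgClosed.cardinal_eq_cardinal_transcendence_basis_of_aleph0_lt _ ht hR (h ▸ hK)
  simp only [lift_id] at h₁ h₂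
  obtain ⟨e⟩ : Nonempty (s ≃ t) := Cardinal.eq.mp (by rw [← h₁, ← h₂, h])
  let := IsAlgClosed.isAlgClosure_of_transcendence_basis _ hs
  let := IsAlgClosed.isAlgClosure_of_transcendence_basis _ ht
  let f : adjoin R (Set.range ((↑) : s → K)) ≃ₐ[R] adjoin R (Set.range ((↑) : t → L)) :=
    hs.1.aevalEquiv.symm.trans ((MvPolynomial.renameEquiv R e).trans ht.1.aevalEquiv)
  refine ⟨IsAlgClosure.equivOfEquiv K L f.toRingEquiv, fun x => ?_⟩
  have := IsAlgClosure.equivOfEquiv_algebraMap K L f.toRingEquiv (algebraMap R _ x)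
  rw [← IsScalarTower.algebraMap_apply] at this
  rw [this]
  simp [← IsScalarTower.algebraMap_apply]

/-- Any two embeddings of a countable ring into `ℂ` differ by an automorphism of `ℂ`. -/
theorem exists_ringEquiv_comp_eq {R : Type*} [CommRing R] [Nontrivial R] [Countable R]
    (f g : R →+* ℂ) (hf : Function.Injective f) (hg : Function.Injective g) :
    ∃ σ : ℂ ≃+* ℂ, ∀ x : R, σ (f x) = g x := by
  have hC : Cardinal.aleph0 < Cardinal.mk ℂ := by simpa using Cardinal.aleph0_lt_continuum
  let a₁ := f.toAlgebra
  have h₁ : @FaithfulSMul R ℂ a₁.toSMul :=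
    (@faithfulSMul_iff_algebraMap_injective R ℂ _ _ a₁).mpr hf
  let a₂ := g.toAlgebra
  have h₂ : @FaithfulSMul R ℂ a₂.toSMul :=
    (@faithfulSMul_iff_algebraMap_injective R ℂ _ _ a₂).mpr hg
  exact @exists_ringEquiv_algebraMap R ℂ ℂ _ _ _ _ _ a₁ h₁ _ _ a₂ h₂ hC rfl

theorem countable_mvPolynomial (σ : Type*) [Finite σ] : Countable (MvPolynomial σ ℚ) := by
  rw [← Cardinal.mk_le_aleph0_iff]
  refine MvPolynomial.cardinalMk_le_max_lift.trans ?_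
  simp

/-! ### Specializations that are injective on algebraic extensions -/

/-- A specialization `φ` that keeps the family `a` algebraically independent kills no nonzero
element algebraic over `k[a]`: such an element divides a nonzero element of `k[a]`. -/
theorem eq_zero_of_map_eq_zero_of_algebraicIndependent {k R K ι : Type*} [Field k] [CommRing R]
    [IsDomain R] [Algebra k R] [Field K] [Algebra k K] {a : ι → R} (φ : R →ₐ[k] K)
    (h : AlgebraicIndependent k (φ ∘ a)) {b : R}
    (hb : IsAlgebraic (Algebra.adjoin k (Set.range a)) b) (h0 : φ b = 0) : b = 0 := by
  by_contra hne
  obtain ⟨⟨r, hr⟩, hr0, c, hc⟩ := hb.exists_nonzero_dvd (mem_nonZeroDivisors_of_ne_zero hne)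
  have hφr : φ r = 0 := by
    change r = b * c at hc
    rw [hc, map_mul, h0, zero_mul]
  rw [Algebra.adjoin_range_eq_range_aeval] at hr
  obtain ⟨P, rfl⟩ := hr
  have : MvPolynomial.aeval (φ ∘ a) P = 0 := by
    rw [← hφr]
    exact (MvPolynomial.comp_aeval_apply a φ P).symm
  refine hr0 (Subtype.ext ?_)
  simp [(map_eq_zero_iff _ h).mp this]

/-! ### The Jacobian of algebraically independent polynomials -/

theorem exists_isGeneric_real (σ : Type*) [Finite σ] :
    ∃ ρ : σ → ℝ, AlgebraicIndependent ℚ ρ := by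
  obtain ⟨s, hs⟩ := exists_isTranscendenceBasis ℚ ℝ
  have hs₂ : IsTranscendenceBasis ℚ (algebraMap ℝ ℂ ∘ ((↑) : s → ℝ)) := hs.algebraMap_comp (A := ℂ)
  have hcard := IsAlgClosed.cardinal_eq_cardinal_transcendence_basis_of_aleph0_lt
    _ hs₂ (by simp) (by simpa using Cardinal.aleph0_lt_continuum)
  have hs' : Infinite s := by
    rw [Cardinal.infinite_iff]
    have h : Cardinal.mk ℂ = Cardinal.mk s := by simpa using hcard
    rw [← h]
    simpa using Cardinal.aleph0_le_continuum
  obtain ⟨n, ⟨e⟩⟩ := Finite.exists_equiv_fin σ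
  let f : σ ↪ s := e.toEmbedding.trans (Fin.valEmbedding.trans (Infinite.natEmbedding s))
  exact ⟨fun x => f x, hs.1.comp f f.injective⟩

open MvPolynomial

/-- The directional derivative at the point `ρ`, in the direction `w`, of the polynomial `f`. -/
noncomputable def dirDeriv {σ : Type*} [Fintype σ] (ρ w : σ → ℝ) (f : MvPolynomial σ ℚ) : ℝ :=
  ∑ j, aeval ρ (pderiv j f) * w j

section
variable {σ : Type*} [Fintype σ] (ρ w : σ → ℝ)

theorem dirDeriv_add (f g : MvPolynomial σ ℚ) :
    dirDeriv ρ w (f + g) = dirDeriv ρ w f + dirDeriv ρ w g := by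
  simp [dirDeriv, add_mul, Finset.sum_add_distrib]

theorem dirDeriv_mul (f g : MvPolynomial σ ℚ) :
    dirDeriv ρ w (f * g) = aeval ρ f * dirDeriv ρ w g + aeval ρ g * dirDeriv ρ w f := by
  simp only [dirDeriv, Derivation.leibniz, map_add, smul_eq_mul, map_mul, add_mul,
    Finset.sum_add_distrib, Finset.mul_sum, mul_assoc]

theorem dirDeriv_C (c : ℚ) : dirDeriv ρ w (C c) = 0 := by
  simp [dirDeriv]

theorem dirDeriv_X (j : σ) : dirDeriv ρ w (X j) = w j := by
  classical
  rw [dirDeriv, Finset.sum_eq_single j]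
  · simp
  · intro b _ hb
    simp [pderiv_X_of_ne hb.symm]
  · simp

theorem dirDeriv_pow (f : MvPolynomial σ ℚ) (n : ℕ) :
    dirDeriv ρ w (f ^ n) = n * aeval ρ f ^ (n - 1) * dirDeriv ρ w f := by
  induction n with
  | zero => simpa using dirDeriv_C ρ w 1
  | succ n ih =>
    rw [pow_succ, dirDeriv_mul, ih]
    rcases n with _ | n
    · simp
    · simp only [map_pow, Nat.add_sub_cancel]
      push_cast
      ring

/-- The chain rule for polynomials whose coefficients have vanishing directional derivative. -/
theorem dirDeriv_aeval {T : Subalgebra ℚ (MvPolynomial σ ℚ)} (hT : ∀ t ∈ T, dirDeriv ρ w t = 0)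
    (P : Polynomial T) (x : MvPolynomial σ ℚ) :
    dirDeriv ρ w (Polynomial.aeval x P) =
      aeval ρ (Polynomial.aeval x P.derivative) * dirDeriv ρ w x := by
  induction P using Polynomial.induction_on' with
  | add p q hp hq => simp [dirDeriv_add, hp, hq, add_mul]
  | monomial n a =>
    rw [Polynomial.derivative_monomial, Polynomial.aeval_monomial, Polynomial.aeval_monomial,
      dirDeriv_mul, dirDeriv_pow, show algebraMap T (MvPolynomial σ ℚ) a = a from rfl,
      hT a a.2, map_mul, map_mul, map_natCast, map_mul, map_natCast, map_pow]
    change _ = aeval ρ (a : MvPolynomial σ ℚ) * _ * aeval ρ (x ^ (n - 1)) * _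
    rw [map_pow]
    ring

theorem dirDeriv_eq_zero_of_mem_adjoin {s : Set (MvPolynomial σ ℚ)}
    (hs : ∀ f ∈ s, dirDeriv ρ w f = 0) {f : MvPolynomial σ ℚ} (hf : f ∈ Algebra.adjoin ℚ s) :
    dirDeriv ρ w f = 0 := by
  induction hf using Algebra.adjoin_induction with
  | mem x hx => exact hs x hx
  | algebraMap r => exact dirDeriv_C ρ w r
  | add x y _ _ hx hy => rw [dirDeriv_add, hx, hy, add_zero]
  | mul x y _ _ hx hy => rw [dirDeriv_mul, hx, hy, mul_zero, mul_zero, add_zero]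

/-- At a generic point, a directional derivative vanishing on `T` also vanishes on the elements
algebraic over `T`: differentiate a polynomial relation of minimal degree. -/
theorem dirDeriv_eq_zero_of_isAlgebraic (hρ : AlgebraicIndependent ℚ ρ)
    {T : Subalgebra ℚ (MvPolynomial σ ℚ)} (hT : ∀ t ∈ T, dirDeriv ρ w t = 0)
    {x : MvPolynomial σ ℚ} (hx : IsAlgebraic T x) : dirDeriv ρ w x = 0 := by
  classical
  have hex : ∃ n, ∃ P : Polynomial T, P ≠ 0 ∧ Polynomial.aeval x P = 0 ∧ P.natDegree = n := by
    obtain ⟨P, h0, h1⟩ := hx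
    exact ⟨_, P, h0, h1, rfl⟩
  obtain ⟨P, h0, h1, h2⟩ := Nat.find_spec hex
  -- By minimality the derivative of `P` does not vanish at `x`.
  have hdeg : P.natDegree ≠ 0 := by
    intro h
    rw [Polynomial.eq_C_of_natDegree_eq_zero h] at h1 h0
    simp only [Polynomial.aeval_C] at h1
    refine h0 ?_
    rw [(map_eq_zero_iff (algebraMap T _) Subtype.val_injective).mp h1, map_zero]
  have h3 : Polynomial.aeval x P.derivative ≠ 0 := by
    intro h
    refine Nat.find_min hex (m := P.derivative.natDegree) ?_ ⟨_, ?_, h, rfl⟩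
    · rw [← h2]
      exact Polynomial.natDegree_derivative_lt hdeg
    · intro h
      exact hdeg (Polynomial.derivative_eq_zero.mp h)
  have h4 := dirDeriv_aeval ρ w hT P x
  rw [h1] at h4
  have h5 : dirDeriv ρ w 0 = 0 := by simpa using dirDeriv_C ρ w 0
  rw [h5, eq_comm, mul_eq_zero] at h4
  exact h4.resolve_left fun h => h3 ((map_eq_zero_iff _ hρ).mp h)

/-- The differential at `ρ` of the polynomial function `f`. -/
noncomputable def differential (ρ : σ → ℝ) (f : MvPolynomial σ ℚ) : (σ → ℝ) →L[ℝ] ℝ :=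
  ∑ j, aeval ρ (pderiv j f) • ContinuousLinearMap.proj (R := ℝ) (φ := fun _ => ℝ) j

theorem differential_apply (f : MvPolynomial σ ℚ) : differential ρ f w = dirDeriv ρ w f := by
  simp [differential, dirDeriv]

theorem hasStrictFDerivAt_aeval (f : MvPolynomial σ ℚ) :
    HasStrictFDerivAt (fun x : σ → ℝ => aeval x f) (differential ρ f) ρ := by
  induction f using MvPolynomial.induction_on with
  | C c =>
    have : differential ρ (C c) = 0 := by
      ext1 w
      rw [differential_apply, dirDeriv_C]
      rfl
    rw [this]
    simpa using hasStrictFDerivAt_const (algebraMap ℚ ℝ c) ρ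
  | add p q hp hq =>
    simp only [map_add]
    refine (hp.add hq).congr_fderiv ?_
    ext1 w
    rw [add_apply]
    simp only [differential_apply, dirDeriv_add]
  | mul_X p j hp =>
    have hj : HasStrictFDerivAt (fun x : σ → ℝ => x j)
      (ContinuousLinearMap.proj (R := ℝ) (φ := fun _ => ℝ) j) ρ := hasStrictFDerivAt_apply j ρ
    simp only [map_mul, aeval_X]
    refine (hp.mul hj).congr_fderiv ?_
    ext1 w
    rw [add_apply, smul_apply,
      smul_apply, ContinuousLinearMap.proj_apply]
    simp only [differential_apply, dirDeriv_mul, dirDeriv_X, aeval_X, smul_eq_mul]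

/-- The Jacobian at `ρ` of the polynomial map `g`. -/
noncomputable def jacobian {ι : Type*} (ρ : σ → ℝ) (g : ι → MvPolynomial σ ℚ) :
    (σ → ℝ) →L[ℝ] (ι → ℝ) :=
  ContinuousLinearMap.pi fun i => differential ρ (g i)

theorem jacobian_apply {ι : Type*} (g : ι → MvPolynomial σ ℚ) (i : ι) :
    jacobian ρ g w i = dirDeriv ρ w (g i) :=
  differential_apply ρ w (g i)

theorem hasStrictFDerivAt_jacobian {ι : Type*} [Finite ι] (g : ι → MvPolynomial σ ℚ) :
    HasStrictFDerivAt (fun (x : σ → ℝ) (i : ι) => aeval x (g i)) (jacobian ρ g) ρ := by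
  have := Fintype.ofFinite ι
  exact hasStrictFDerivAt_pi.mpr fun i => hasStrictFDerivAt_aeval ρ (g i)

/-- Algebraically independent polynomials have a Jacobian of full rank at every generic point. For a
transcendence basis the Jacobian is square, and it is injective because every variable is algebraic
over the basis. -/
theorem jacobian_surjective {ι : Type*} {ρ : σ → ℝ} (hρ : AlgebraicIndependent ℚ ρ)
    {g : ι → MvPolynomial σ ℚ} (hg : AlgebraicIndependent ℚ g) :
    Function.Surjective (jacobian ρ g) := by
  obtain ⟨B, hB, hbasis⟩ := exists_isTranscendenceBasis_superset hg.to_subtype_range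
  have hX : IsTranscendenceBasis ℚ (X : σ → MvPolynomial σ ℚ) :=
    IsTranscendenceBasis.mvPolynomial σ ℚ
  have hcard := hX.lift_cardinalMk_eq hbasis
  obtain ⟨e⟩ := Cardinal.lift_mk_eq'.mp hcard
  have : Finite B := Finite.of_equiv σ e
  have := Fintype.ofFinite B
  have hinj : Function.Injective (jacobian ρ ((↑) : B → MvPolynomial σ ℚ)) := by
    rw [injective_iff_map_eq_zero]
    intro w hw
    ext j
    have hT : ∀ t ∈ Algebra.adjoin ℚ B, dirDeriv ρ w t = 0 := fun t ht =>
      dirDeriv_eq_zero_of_mem_adjoin ρ w (fun f hf => by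
        rw [← jacobian_apply ρ w ((↑) : B → MvPolynomial σ ℚ) ⟨f, hf⟩, hw, Pi.zero_apply]) ht
    have halg : IsAlgebraic (Algebra.adjoin ℚ B) (X j : MvPolynomial σ ℚ) := by
      have := hbasis.isAlgebraic
      rw [Subtype.range_coe] at this
      exact this.isAlgebraic _
    rw [← dirDeriv_X ρ w j]
    exact dirDeriv_eq_zero_of_isAlgebraic ρ w hρ hT halg
  have hsurj : Function.Surjective (jacobian ρ ((↑) : B → MvPolynomial σ ℚ)) := by
    refine (LinearMap.injective_iff_surjective_of_finrank_eq_finrank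
      (f := (jacobian ρ ((↑) : B → MvPolynomial σ ℚ)).toLinearMap) ?_).mp hinj
    simp [Fintype.card_congr e]
  -- Prescribe the derivatives of the other members of the basis to be zero.
  intro y
  let u : ι → B := fun i => ⟨g i, hB ⟨i, rfl⟩⟩
  have hu : Function.Injective u := fun i j h => hg.injective (congrArg Subtype.val h)
  obtain ⟨w, hw⟩ := hsurj (Function.extend u y 0)
  refine ⟨w, funext fun i => ?_⟩
  have := congrFun hw (u i)
  rw [hu.extend_apply, jacobian_apply] at this
  rw [jacobian_apply, ← this]

end

open Topology

/-! ### Edge lengths as polynomials -/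

section
variable {V : Type*} {K : Type*} [Field K] [Algebra ℚ K] {d : ℕ}

/-- The squared distance between the vertices `u` and `v` as a polynomial in the coordinates of a
realization. -/
noncomputable def distPoly (d : ℕ) (u v : V) : MvPolynomial (V × Fin d) ℚ :=
  ∑ i, (X (u, i) - X (v, i)) ^ 2

theorem distPoly_comm (u v : V) : distPoly d u v = distPoly d v u :=
  Finset.sum_congr rfl fun _ _ => by ring

/-- The squared length of an edge as a polynomial in the coordinates of a realization. -/
noncomputable def edgePoly (d : ℕ) : Sym2 V → MvPolynomial (V × Fin d) ℚ :=
  Sym2.lift ⟨distPoly d, distPoly_comm⟩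

@[simp] theorem edgePoly_mk (u v : V) : edgePoly d s(u, v) = distPoly d u v := rfl

/-- Evaluation of polynomials in the coordinates at a realization. -/
noncomputable def evalAt (p : V → Fin d → K) : MvPolynomial (V × Fin d) ℚ →ₐ[ℚ] K :=
  aeval fun x => p x.1 x.2

theorem evalAt_distPoly (p : V → Fin d → K) (u v : V) :
    evalAt p (distPoly d u v) = ∑ i, (p u i - p v i) ^ 2 := by
  simp [evalAt, distPoly]

theorem evalAt_distPoly_complex (p : V → Fin d → ℂ) (u v : V) :
    evalAt p (distPoly d u v) = sqNorm (p u - p v) := by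
  rw [evalAt_distPoly]; rfl

theorem evalAt_distPoly_real (ρ : V → EuclideanSpace ℝ (Fin d)) (u v : V) :
    evalAt (fun v i => ρ v i) (distPoly d u v) = ‖ρ u - ρ v‖ ^ 2 := by
  rw [evalAt_distPoly, EuclideanSpace.real_norm_sq_eq]; rfl

theorem norm_sub_eq_iff (ρ ρ' : V → EuclideanSpace ℝ (Fin d)) (u v : V) :
    ‖ρ' u - ρ' v‖ = ‖ρ u - ρ v‖ ↔
      evalAt (fun v i => ρ' v i) (distPoly d u v) = evalAt (fun v i => ρ v i) (distPoly d u v) := by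
  rw [evalAt_distPoly_real, evalAt_distPoly_real,
    pow_left_inj₀ (norm_nonneg _) (norm_nonneg _) two_ne_zero]

theorem IsGeneric.evalAt_injective {p : V → Fin d → K} (hp : IsGeneric p) :
    Function.Injective (evalAt p) := hp

end

theorem eq_on_adjoin {k R K : Type*} [CommRing k] [CommRing R] [Algebra k R] [CommRing K]
    [Algebra k K] {φ ψ : R →ₐ[k] K} {s : Set R} (h : ∀ x ∈ s, φ x = ψ x) :
    ∀ x ∈ Algebra.adjoin k s, φ x = ψ x :=
  Algebra.adjoin_le (S := AlgHom.equalizer φ ψ) h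

/-- If `x` is algebraic over `T`, then only finitely many values at `x` are taken by the
specializations that agree on `T` with a given one that is injective there. -/
theorem finite_values_of_isAlgebraic {k R K : Type*} [CommRing k] [CommRing R] [Algebra k R]
    [Field K] [Algebra k K] (φ₀ : R →ₐ[k] K) {T : Subalgebra k R}
    (hinj : ∀ t ∈ T, φ₀ t = 0 → t = 0) {x : R} (hx : IsAlgebraic T x) :
    {c : K | ∃ φ : R →ₐ[k] K, (∀ t ∈ T, φ t = φ₀ t) ∧ φ x = c}.Finite := by
  obtain ⟨P, hP0, hP⟩ := hx
  let ψ : T →+* K := (φ₀.comp T.val : T →ₐ[k] K)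
  have hψ : Function.Injective ψ := by
    rw [injective_iff_map_eq_zero]
    exact fun t ht => Subtype.ext (hinj t t.2 ht)
  have hne : P.map ψ ≠ 0 := (Polynomial.map_ne_zero_iff hψ).mpr hP0
  refine (P.map ψ).rootSet_finite K |>.subset ?_
  rintro c ⟨φ, hφ, rfl⟩
  rw [Polynomial.mem_rootSet]
  refine ⟨hne, ?_⟩
  have h1 : (φ : R →+* K).comp (algebraMap T R) = ψ := RingHom.ext fun t => hφ t t.2
  have h2 : φ (Polynomial.aeval x P) = 0 := by rw [hP, map_zero]
  change (φ : R →+* K) (Polynomial.aeval x P) = 0 at h2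
  rw [Polynomial.aeval_def, Polynomial.hom_eval₂, h1] at h2
  rw [Polynomial.aeval_def, Algebra.algebraMap_self, Polynomial.eval₂_map]
  exact h2

section
variable {V : Type*} {d : ℕ} {G : SimpleGraph V}

/-! ### The lengths of a minimally rigid graph -/

theorem isRigid_iff_eventually [Finite V] : IsRigid d G ↔
    ∀ ρ : V → EuclideanSpace ℝ (Fin d), IsGeneric (fun v i => ρ v i) →
      ∀ᶠ ρ' in 𝓝 ρ, (∀ u v, G.Adj u v → ‖ρ' u - ρ' v‖ = ‖ρ u - ρ v‖) →
        ∀ u v, ‖ρ' u - ρ' v‖ = ‖ρ u - ρ v‖ := by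
  have := Fintype.ofFinite V
  refine forall₂_congr fun ρ _ => ?_
  rw [Metric.eventually_nhds_iff]
  refine exists_congr fun ε => and_congr_right fun hε => forall_congr' fun ρ' => ?_
  have : dist ρ' ρ < ε ↔ ∀ v, ‖ρ v - ρ' v‖ < ε := by
    rw [dist_comm, dist_pi_lt_iff hε]
    simp only [dist_eq_norm]
  rw [this]
  exact ⟨fun h h1 h2 => h h2 h1, fun h h1 h2 => h h2 h1⟩

theorem continuous_evalAt (f : MvPolynomial (V × Fin d) ℚ) :
    Continuous fun ρ : V → EuclideanSpace ℝ (Fin d) => evalAt (fun v i => ρ v i) f := by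
  have h1 : Continuous fun ρ : V → EuclideanSpace ℝ (Fin d) => fun x : V × Fin d => ρ x.1 x.2 := by
    fun_prop
  have h2 : Continuous fun y : V × Fin d → ℝ => aeval y f := by
    simp only [aeval_def, eval₂_eq]
    fun_prop
  exact h2.comp h1

/-- An edge whose length is algebraic over the lengths of other edges can be deleted: near a generic
realization its length is determined by the others, as it can take only finitely many values. -/
theorem IsRigid.deleteEdges_of_isAlgebraic [Finite V] (hG : IsRigid d G) {e : Sym2 V}
    {t : Set (Sym2 V)} (ht : t ⊆ G.edgeSet) (het : e ∉ t)
    (halg : IsAlgebraic (Algebra.adjoin ℚ (edgePoly d '' t)) (edgePoly d e)) :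
    IsRigid d (G.deleteEdges {e}) := by
  rw [isRigid_iff_eventually] at hG ⊢
  intro ρ hρ
  have hfin := finite_values_of_isAlgebraic (evalAt fun v i => ρ v i)
    (fun t _ h => (map_eq_zero_iff _ hρ.evalAt_injective).mp h) halg
  -- The values other than the one at `ρ` stay away from `ρ`.
  have hcl := (hfin.subset
    (Set.sdiff_subset (t := {evalAt (fun v i => ρ v i) (edgePoly d e)}))).isClosed
  have hev : ∀ᶠ ρ' in 𝓝 ρ, evalAt (fun v i => ρ' v i) (edgePoly d e) ∈ (_ \ _)ᶜ :=
    (continuous_evalAt (edgePoly d e)).continuousAt.eventually_mem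
      (hcl.isOpen_compl.mem_nhds (fun h => h.2 rfl))
  filter_upwards [hG ρ hρ, hev] with ρ' h1 h2 h3
  apply h1
  have h4 : ∀ f ∈ edgePoly d '' t,
      evalAt (fun v i => ρ' v i) f = evalAt (fun v i => ρ v i) f := by
    rintro _ ⟨e', he', rfl⟩
    induction e' with
    | _ u v =>
      refine (norm_sub_eq_iff ρ ρ' u v).mp (h3 u v ?_)
      rw [SimpleGraph.deleteEdges_adj]
      exact ⟨ht he', fun h => het (h ▸ he')⟩
  have h5 : evalAt (fun v i => ρ' v i) (edgePoly d e) =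
      evalAt (fun v i => ρ v i) (edgePoly d e) := by
    by_contra hne
    exact h2 ⟨⟨_, eq_on_adjoin h4, rfl⟩, hne⟩
  intro u v huv
  by_cases he : s(u, v) = e
  · subst he
    exact (norm_sub_eq_iff ρ ρ' u v).mpr h5
  · refine h3 u v ?_
    rw [SimpleGraph.deleteEdges_adj]
    exact ⟨huv, he⟩

/-- The squared edge lengths of a minimally rigid graph are algebraically independent, as otherwise
an edge could be deleted. -/
theorem IsMinimallyRigid.algebraicIndependent [Finite V] (hG : IsMinimallyRigid d G) :
    AlgebraicIndependent ℚ fun e : G.edgeSet => edgePoly d (e : Sym2 V) := by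
  refine algebraicIndependent_of_finite_type' (algebraMap ℚ _).injective fun t _ _ e he halg => ?_
  refine hG.2 e e.2 (hG.1.deleteEdges_of_isAlgebraic (t := Subtype.val '' t) ?_ ?_ ?_)
  · rintro _ ⟨x, _, rfl⟩
    exact x.2
  · rwa [Subtype.val_injective.mem_set_image]
  · rwa [← Set.image_comp]

/-- In a minimally rigid graph all distances are algebraic over the edge lengths. Otherwise the edge
lengths and one more distance would be algebraically independent, so by the open mapping property of
submersions that distance could be perturbed near a generic realization while keeping all edge
lengths. -/
theorem IsMinimallyRigid.isAlgebraic_distPoly [Finite V] (hG : IsMinimallyRigid d G) (u v : V) :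
    IsAlgebraic (Algebra.adjoin ℚ (Set.range fun e : G.edgeSet => edgePoly d (e : Sym2 V)))
      (distPoly d u v) := by
  have := Fintype.ofFinite V
  by_contra htr
  have hind := (hG.algebraicIndependent.option_iff_transcendental (distPoly d u v)).mpr htr
  obtain ⟨x, hx⟩ := exists_isGeneric_real (V × Fin d)
  set g : Option G.edgeSet → MvPolynomial (V × Fin d) ℚ :=
    fun o => o.elim (distPoly d u v) fun e => edgePoly d (e : Sym2 V) with hg
  have := Fintype.ofFinite (Option G.edgeSet)
  have hopen := (hasStrictFDerivAt_jacobian x g).map_nhds_eq_of_surj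
    (LinearMap.range_eq_top.mpr (by exact jacobian_surjective hx hind))
  set F : (V × Fin d → ℝ) → Option G.edgeSet → ℝ := fun y o => aeval y (g o) with hF
  let toReal : (V × Fin d → ℝ) → V → EuclideanSpace ℝ (Fin d) :=
    fun y v => WithLp.toLp 2 fun i => y (v, i)
  have hcont : Continuous toReal := by fun_prop
  have hrig := hcont.continuousAt.eventually (isRigid_iff_eventually.mp hG.1 (toReal x) hx)
  change _ = 𝓝 (F x) at hopen
  have himage := hopen ▸ Filter.image_mem_map hrig
  classical
  -- Perturb only the length of the pair `u`, `v`.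
  let z : ℝ → Option G.edgeSet → ℝ := fun δ => Function.update (F x) none (F x none + δ)
  have hz : Continuous z := by fun_prop
  have hz0 : z 0 = F x := by simp [z]
  rw [← hz0] at himage
  have hev := (hz.continuousAt.eventually_mem himage).filter_mono
    (nhdsWithin_le_nhds (s := {(0 : ℝ)}ᶜ))
  obtain ⟨δ, ⟨y, hy, hyz⟩, hδ⟩ := (hev.and self_mem_nhdsWithin).exists
  have hval : ∀ (y : V × Fin d → ℝ) (f : MvPolynomial (V × Fin d) ℚ),
      evalAt (fun v i => toReal y v i) f = aeval y f := fun _ _ => rfl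
  have h1 := hy (fun a b hab => by
    rw [norm_sub_eq_iff, hval, hval]
    have h := congrFun hyz (some ⟨s(a, b), hab⟩)
    simpa [z, hF, hg] using h) u v
  rw [norm_sub_eq_iff, hval, hval] at h1
  have h := congrFun hyz none
  simp only [z, hF, hg, Function.update_self, Option.elim_none, h1] at h
  exact hδ (by simpa using h)

end

open Matrix

/-! ### Complex point configurations with equal distances -/

/-- Two bases of `ℂ^n` (the rows of `N` and of `N'`) with the same Gram matrix are related by an
orthogonal matrix. The conclusion speaks of coordinates with respect to these bases. -/
theorem exists_orthogonal_of_gram_eq {n : Type*} [Fintype n] [DecidableEq n] {N N' : Matrix n n ℂ}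
    (hN : IsUnit N.det) (h : N * Nᵀ = N' * N'ᵀ) :
    ∃ A : Matrix n n ℂ, Aᵀ * A = 1 ∧ ∀ z z', N *ᵥ z = N' *ᵥ z' → A *ᵥ z = z' := by
  have hN' : IsUnit N'.det := by
    have := congrArg Matrix.det h
    rw [det_mul, det_mul, det_transpose, det_transpose] at this
    exact isUnit_of_mul_isUnit_left (this ▸ hN.mul hN)
  refine ⟨N'⁻¹ * N, ?_, fun z z' hz => ?_⟩
  · have h1 : (N'⁻¹ * N) * (N'⁻¹ * N)ᵀ = 1 := by
      rw [transpose_mul, transpose_nonsing_inv, Matrix.mul_assoc, ← Matrix.mul_assoc N, h,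
        Matrix.mul_assoc N', mul_nonsing_inv _ (by rwa [det_transpose]), Matrix.mul_one,
        nonsing_inv_mul _ hN']
    exact mul_eq_one_comm.mp h1
  · rw [← mulVec_mulVec, hz, mulVec_mulVec, nonsing_inv_mul _ hN', one_mulVec]

section
variable {m : ℕ}

/-- The square matrix with first row `n` followed by the rows of `X`. -/
def consRow (n : Fin (m + 1) → ℂ) (X : Matrix (Fin m) (Fin (m + 1)) ℂ) :
    Matrix (Fin (m + 1)) (Fin (m + 1)) ℂ :=
  Matrix.of (vecCons n X)

theorem consRow_mulVec (n : Fin (m + 1) → ℂ) (X : Matrix (Fin m) (Fin (m + 1)) ℂ)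
    (z : Fin (m + 1) → ℂ) : consRow n X *ᵥ z = vecCons (n ⬝ᵥ z) (X *ᵥ z) :=
  cons_mulVec n X z

theorem consRow_det_ne_zero {n : Fin (m + 1) → ℂ} {X : Matrix (Fin m) (Fin (m + 1)) ℂ}
    (hX : (X * Xᵀ).det ≠ 0) (hn : n ≠ 0) (hXn : X *ᵥ n = 0) : (consRow n X).det ≠ 0 := by
  intro h0
  obtain ⟨v, hv, hv0⟩ := exists_vecMul_eq_zero_iff.mpr h0
  have h1 : v 0 • n + (fun j => v j.succ) ᵥ* X = 0 := by
    rw [← hv0, consRow, ← cons_head_tail v, cons_vecMul]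
    rfl
  have h2 : (fun j => v j.succ) ᵥ* (X * Xᵀ) = 0 := by
    have := congrArg (X *ᵥ ·) h1
    simp only [mulVec_add, mulVec_smul, hXn, smul_zero, zero_add, mulVec_zero] at this
    rw [← vecMul_vecMul, vecMul_transpose, this]
  have h3 : (fun j : Fin m => v j.succ) = 0 := by
    by_contra hne
    exact hX (exists_vecMul_eq_zero_iff.mp ⟨_, hne, h2⟩)
  rw [h3, zero_vecMul, add_zero, smul_eq_zero, or_iff_left hn] at h1
  apply hv
  ext i
  refine Fin.cases h1 (fun j => congrFun h3 j) i

/-- The orthogonal complement of a nondegenerate hyperplane contains a unit vector; this uses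
that `ℂ` has square roots. -/
theorem exists_unit_normal {X : Matrix (Fin m) (Fin (m + 1)) ℂ} (hX : (X * Xᵀ).det ≠ 0) :
    ∃ n : Fin (m + 1) → ℂ, X *ᵥ n = 0 ∧ n ⬝ᵥ n = 1 := by
  obtain ⟨n, hn0, hn⟩ : ∃ n : Fin (m + 1) → ℂ, n ≠ 0 ∧ X *ᵥ n = 0 := by
    have h := LinearMap.ker_ne_bot_of_finrank_lt (f := X.mulVecLin) (by simp)
    obtain ⟨n, hn, hn0⟩ := (Submodule.ne_bot_iff _).mp h
    exact ⟨n, hn0, hn⟩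
  have hnn : n ⬝ᵥ n ≠ 0 := by
    intro h
    refine consRow_det_ne_zero hX hn0 hn (exists_mulVec_eq_zero_iff.mp ⟨n, hn0, ?_⟩)
    rw [consRow_mulVec, h, hn]
    simp
  obtain ⟨s, hs⟩ := IsAlgClosed.exists_pow_nat_eq (n ⬝ᵥ n) two_pos
  have hs0 : s ≠ 0 := by rintro rfl; simp at hs; exact hnn hs.symm
  refine ⟨s⁻¹ • n, by rw [mulVec_smul, hn, smul_zero], ?_⟩
  rw [smul_dotProduct, dotProduct_smul, ← hs, smul_eq_mul, smul_eq_mul]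
  field_simp

theorem consRow_mul_transpose {n : Fin (m + 1) → ℂ} {X : Matrix (Fin m) (Fin (m + 1)) ℂ}
    (hXn : X *ᵥ n = 0) (hn : n ⬝ᵥ n = 1) (i j : Fin (m + 1)) :
    (consRow n X * (consRow n X)ᵀ) i j =
      Fin.cases (Fin.cases 1 0 j) (fun i' => Fin.cases 0 (fun j' => (X * Xᵀ) i' j') j) i := by
  have h : ∀ k, X k ⬝ᵥ n = 0 := fun k => congrFun hXn k
  change consRow n X i ⬝ᵥ consRow n X j = _
  refine Fin.cases ?_ (fun i => ?_) i <;> refine Fin.cases ?_ (fun j => ?_) j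
  · exact hn
  · exact (dotProduct_comm _ _).trans (h j)
  · exact h i
  · rfl

/-- A case of Witt's theorem: vectors with the same inner products are related by an orthogonal
matrix, provided that some of them form a basis of a nondegenerate hyperplane. -/
theorem exists_orthogonal_of_dotProduct_eq {U : Type*} (x y : U → Fin (m + 1) → ℂ)
    (h : ∀ v w, x v ⬝ᵥ x w = y v ⬝ᵥ y w) (u : Fin m → U)
    (hdet : (Matrix.of (x ∘ u) * (Matrix.of (x ∘ u))ᵀ).det ≠ 0) :
    ∃ A : Matrix (Fin (m + 1)) (Fin (m + 1)) ℂ, Aᵀ * A = 1 ∧ ∀ v, A *ᵥ x v = y v := by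
  set X : Matrix (Fin m) (Fin (m + 1)) ℂ := Matrix.of (x ∘ u) with hX
  set Y : Matrix (Fin m) (Fin (m + 1)) ℂ := Matrix.of (y ∘ u) with hY
  have hXY : X * Xᵀ = Y * Yᵀ := by
    ext i j
    exact h (u i) (u j)
  have hXYv : ∀ v, X *ᵥ x v = Y *ᵥ y v := fun v => funext fun i => h (u i) v
  obtain ⟨n, hn, hn1⟩ := exists_unit_normal hdet
  obtain ⟨n', hn', hn1'⟩ := exists_unit_normal (hXY ▸ hdet)
  have hunit : IsUnit (consRow n X).det := by
    refine (consRow_det_ne_zero hdet ?_ hn).isUnit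
    rintro rfl
    simp at hn1
  have key : ∀ n'', Y *ᵥ n'' = 0 → n'' ⬝ᵥ n'' = 1 →
      ∃ A : Matrix (Fin (m + 1)) (Fin (m + 1)) ℂ, Aᵀ * A = 1 ∧
        ∀ z z', n ⬝ᵥ z = n'' ⬝ᵥ z' → X *ᵥ z = Y *ᵥ z' → A *ᵥ z = z' := by
    intro n'' h1 h2
    obtain ⟨A, hA, hA'⟩ := exists_orthogonal_of_gram_eq (N' := consRow n'' Y) hunit (by
      ext i j
      rw [consRow_mul_transpose hn hn1, consRow_mul_transpose h1 h2, hXY])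
    refine ⟨A, hA, fun z z' h3 h4 => hA' z z' ?_⟩
    rw [consRow_mulVec, consRow_mulVec, h3, h4]
  -- The components along the unit normals have the same products.
  have hc : ∀ v w, (n ⬝ᵥ x v) * (n ⬝ᵥ x w) = (n' ⬝ᵥ y v) * (n' ⬝ᵥ y w) := by
    obtain ⟨A, hA, hA'⟩ := key n' hn' hn1'
    intro v w
    have hz : ∀ v, A *ᵥ (x v - (n ⬝ᵥ x v) • n) = y v - (n' ⬝ᵥ y v) • n' := fun v => hA' _ _
      (by rw [dotProduct_sub, dotProduct_sub, dotProduct_smul, dotProduct_smul, hn1, hn1']; simp)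
      (by rw [mulVec_sub, mulVec_sub, mulVec_smul, mulVec_smul, hn, hn', hXYv, smul_zero,
        smul_zero])
    have hprod : (x v - (n ⬝ᵥ x v) • n) ⬝ᵥ (x w - (n ⬝ᵥ x w) • n) =
        (y v - (n' ⬝ᵥ y v) • n') ⬝ᵥ (y w - (n' ⬝ᵥ y w) • n') := by
      rw [← hz, ← hz, dotProduct_mulVec, vecMul_mulVec, hA, vecMul_one]
    simp only [dotProduct_sub, sub_dotProduct, dotProduct_smul, smul_dotProduct, smul_eq_mul,
      hn1, hn1', dotProduct_comm _ n, dotProduct_comm _ n', h] at hprod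
    linear_combination -hprod
  -- Hence they agree up to a global sign, which is absorbed into the normal.
  obtain ⟨n'', h1, h2, h3⟩ : ∃ n'', Y *ᵥ n'' = 0 ∧ n'' ⬝ᵥ n'' = 1 ∧
      ∀ v, n ⬝ᵥ x v = n'' ⬝ᵥ y v := by
    by_cases hall : ∀ v, n ⬝ᵥ x v = n' ⬝ᵥ y v
    · exact ⟨n', hn', hn1', hall⟩
    · push Not at hall
      obtain ⟨v, hv⟩ := hall
      refine ⟨-n', by rw [mulVec_neg, hn', neg_zero], by simpa using hn1', fun w => ?_⟩
      rw [neg_dotProduct]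
      have hv' : n ⬝ᵥ x v = -(n' ⬝ᵥ y v) := by
        have := hc v v
        rw [mul_self_eq_mul_self_iff] at this
        exact this.resolve_left hv
      have hne : n' ⬝ᵥ y v ≠ 0 := fun h0 => hv (by rw [hv', h0, neg_zero])
      have := hc v w
      rw [hv', neg_mul, ← mul_neg] at this
      have := mul_left_cancel₀ hne this
      rw [← this, neg_neg]
  obtain ⟨A, hA, hA'⟩ := key n'' h1 h2
  exact ⟨A, hA, fun v => hA' _ _ (h3 v) (hXYv v)⟩

/-- A rotation that fixes a nondegenerate hyperplane pointwise is the identity: it scales the unit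
normal by its determinant. -/
theorem eq_one_of_mulVec_eq_self {X : Matrix (Fin m) (Fin (m + 1)) ℂ}
    (hX : (X * Xᵀ).det ≠ 0) {A : Matrix (Fin (m + 1)) (Fin (m + 1)) ℂ} (hA : Aᵀ * A = 1)
    (hdet : A.det = 1) (hfix : ∀ j, A *ᵥ X j = X j) : A = 1 := by
  obtain ⟨n, hn, hn1⟩ := exists_unit_normal hX
  have hn0 : n ≠ 0 := by
    rintro rfl
    simp at hn1
  have hunit := (consRow_det_ne_zero hX hn0 hn).isUnit
  have hinj : Function.Injective ((consRow n X).mulVec) :=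
    mulVec_injective_of_isUnit ((isUnit_iff_isUnit_det _).mpr hunit)
  have hAn : A *ᵥ n = (n ⬝ᵥ A *ᵥ n) • n := by
    apply hinj
    rw [mulVec_smul, consRow_mulVec, consRow_mulVec, hn, hn1]
    have : X *ᵥ A *ᵥ n = 0 := by
      ext j
      change X j ⬝ᵥ A *ᵥ n = 0
      rw [← hfix j, dotProduct_mulVec, vecMul_mulVec, hA, vecMul_one]
      exact congrFun hn j
    rw [this]
    simp
  have hrow : consRow n X * Aᵀ = updateRow (consRow n X) 0 ((n ⬝ᵥ A *ᵥ n) • n) := by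
    ext i j
    have : (consRow n X * Aᵀ) i j = (A *ᵥ consRow n X i) j := dotProduct_comm _ _
    rw [this]
    refine Fin.cases ?_ (fun i => ?_) i
    · rw [updateRow_self, ← hAn]; rfl
    · rw [updateRow_ne (Fin.succ_ne_zero i)]
      exact congrFun (hfix i) j
  have hs : n ⬝ᵥ A *ᵥ n = 1 := by
    have := congrArg Matrix.det hrow
    rw [det_mul, det_transpose, hdet, det_updateRow_smul, mul_one] at this
    have h2 : updateRow (consRow n X) 0 n = consRow n X := updateRow_eq_self _ _
    rw [h2] at this
    exact (mul_right_cancel₀ hunit.ne_zero ((one_mul _).trans this)).symm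
  have h3 : consRow n X * Aᵀ = consRow n X * 1 := by
    rw [hrow, hs, one_smul, mul_one]
    exact updateRow_eq_self _ _
  have h4 := ((isUnit_iff_isUnit_det _).mpr hunit).mul_left_cancel h3
  rw [← transpose_transpose A, h4, transpose_one]

end

/-- The matrix with rows `p (u j) - p (u 0)` for `j ≠ 0`. Its Gram matrix is invertible when the
points `p (u j)` affinely span a nondegenerate hyperplane. -/
def frameMatrix {V : Type*} {m : ℕ} (u : Fin (m + 1) → V) (p : V → Fin (m + 1) → ℂ) :
    Matrix (Fin m) (Fin (m + 1)) ℂ :=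
  Matrix.of fun j => p (u j.succ) - p (u 0)

theorem sqNorm_eq_dotProduct {d : ℕ} (x : Fin d → ℂ) : sqNorm x = x ⬝ᵥ x := by
  simp [sqNorm, dotProduct, sq]

theorem dotProduct_eq_sqNorm {d : ℕ} (x y o : Fin d → ℂ) :
    (x - o) ⬝ᵥ (y - o) = (1 / 2) * (sqNorm (x - o) + sqNorm (y - o) - sqNorm (x - y)) := by
  simp only [sqNorm_eq_dotProduct, dotProduct_sub, sub_dotProduct, dotProduct_comm y x,
    dotProduct_comm o x, dotProduct_comm o y]
  ring

/-- Realizations with the same distances differ by an isometry, possibly an indirect one, if some of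
the points affinely span a nondegenerate hyperplane. -/
theorem exists_congruence {V : Type*} {m : ℕ} {p q : V → Fin (m + 1) → ℂ}
    (h : ∀ v w, sqNorm (q v - q w) = sqNorm (p v - p w)) (u : Fin (m + 1) → V)
    (hu : (frameMatrix u p * (frameMatrix u p)ᵀ).det ≠ 0) :
    ∃ (A : Matrix (Fin (m + 1)) (Fin (m + 1)) ℂ) (b : Fin (m + 1) → ℂ),
      Aᵀ * A = 1 ∧ ∀ v, q v = A *ᵥ p v + b := by
  obtain ⟨A, hA, hA'⟩ := exists_orthogonal_of_dotProduct_eq (fun v => p v - p (u 0))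
    (fun v => q v - q (u 0)) (fun v w => by
      rw [dotProduct_eq_sqNorm, dotProduct_eq_sqNorm, h, h, h]) (fun j => u j.succ) hu
  refine ⟨A, q (u 0) - A *ᵥ p (u 0), hA, fun v => ?_⟩
  have := hA' v
  rw [mulVec_sub] at this
  rw [eq_add_of_sub_eq this.symm]
  abel

theorem eq_one_and_eq_zero_of_fixes {V : Type*} {m : ℕ} {p : V → Fin (m + 1) → ℂ}
    (u : Fin (m + 1) → V) (hu : (frameMatrix u p * (frameMatrix u p)ᵀ).det ≠ 0)
    {A : Matrix (Fin (m + 1)) (Fin (m + 1)) ℂ} {b : Fin (m + 1) → ℂ} (hA : Aᵀ * A = 1)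
    (hdet : A.det = 1) (hfix : ∀ v, p v = A *ᵥ p v + b) : A = 1 ∧ b = 0 := by
  have h1 : A = 1 := eq_one_of_mulVec_eq_self hu hA hdet fun j => by
    change A *ᵥ (p (u j.succ) - p (u 0)) = p (u j.succ) - p (u 0)
    rw [mulVec_sub]
    rw [eq_sub_of_add_eq (hfix (u j.succ)).symm, eq_sub_of_add_eq (hfix (u 0)).symm]
    abel
  refine ⟨h1, ?_⟩
  have := hfix (u 0)
  rw [h1, one_mulVec] at this
  exact left_eq_add.mp this

/-! ### Realizations equivalent to a generic one -/

section
variable {V : Type*} {d : ℕ} {G : SimpleGraph V}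

theorem equivalent_iff {p q : V → Fin d → ℂ} : Equivalent G p q ↔
    ∀ e ∈ G.edgeSet, evalAt q (edgePoly d e) = evalAt p (edgePoly d e) := by
  constructor
  · intro h e
    induction e with
    | _ a b =>
      intro he
      rw [edgePoly_mk, evalAt_distPoly_complex, evalAt_distPoly_complex]
      exact h a b he
  · intro h a b hab
    have := h s(a, b) hab
    rwa [edgePoly_mk, evalAt_distPoly_complex, evalAt_distPoly_complex] at this

theorem IsMinimallyRigid.isAlgebraic_of_mem_adjoin [Finite V] (hG : IsMinimallyRigid d G)
    {f : MvPolynomial (V × Fin d) ℚ}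
    (hf : f ∈ Algebra.adjoin ℚ (Set.range fun x : V × V => distPoly d x.1 x.2)) :
    IsAlgebraic (Algebra.adjoin ℚ (Set.range fun e : G.edgeSet => edgePoly d (e : Sym2 V))) f := by
  induction hf using Algebra.adjoin_induction with
  | mem x hx =>
    obtain ⟨⟨a, b⟩, rfl⟩ := hx
    exact hG.isAlgebraic_distPoly a b
  | algebraMap r => exact isAlgebraic_algebraMap (algebraMap ℚ (Algebra.adjoin ℚ _) r)
  | add x y _ _ hx hy => exact hx.add hy
  | mul x y _ _ hx hy => exact hx.mul hy

/-- The distances of a realization equivalent to a generic one satisfy no algebraic relation other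
than those holding identically, even though the realization itself need not be generic. -/
theorem IsMinimallyRigid.eq_zero_of_evalAt_eq_zero [Finite V] (hG : IsMinimallyRigid d G)
    {p q : V → Fin d → ℂ} (hp : IsGeneric p) (hq : Equivalent G p q)
    {f : MvPolynomial (V × Fin d) ℚ}
    (hf : f ∈ Algebra.adjoin ℚ (Set.range fun x : V × V => distPoly d x.1 x.2))
    (h0 : evalAt q f = 0) : f = 0 := by
  refine eq_zero_of_map_eq_zero_of_algebraicIndependent (evalAt q) ?_
    (hG.isAlgebraic_of_mem_adjoin hf) h0
  have h := hG.algebraicIndependent.map' (f := evalAt p) hp.evalAt_injective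
  have heq : (evalAt q ∘ fun e : G.edgeSet => edgePoly d (e : Sym2 V)) =
      evalAt p ∘ fun e : G.edgeSet => edgePoly d (e : Sym2 V) :=
    funext fun e => equivalent_iff.mp hq e e.2
  rw [heq]
  exact h

end

section
variable {V : Type*} {m : ℕ} {G : SimpleGraph V}

/-- The determinant of the Gram matrix of `frameMatrix u`, written in terms of distances. -/
noncomputable def gramPoly (u : Fin (m + 1) → V) : MvPolynomial (V × Fin (m + 1)) ℚ :=
  Matrix.det <| Matrix.of fun i j : Fin m => MvPolynomial.C (1 / 2) *
    (distPoly (m + 1) (u i.succ) (u 0) + distPoly (m + 1) (u j.succ) (u 0) -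
      distPoly (m + 1) (u i.succ) (u j.succ))

theorem evalAt_gramPoly (u : Fin (m + 1) → V) (q : V → Fin (m + 1) → ℂ) :
    evalAt q (gramPoly u) = (frameMatrix u q * (frameMatrix u q)ᵀ).det := by
  rw [gramPoly, AlgHom.map_det]
  congr 1
  ext i j
  have h : evalAt q (MvPolynomial.C (1 / 2 : ℚ)) = 1 / 2 := by
    rw [evalAt, MvPolynomial.aeval_C]
    norm_num
  simp only [AlgHom.mapMatrix_apply, map_apply, of_apply, map_mul, h, map_sub, map_add,
    evalAt_distPoly_complex]
  exact (dotProduct_eq_sqNorm _ _ _).symm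

theorem gramPoly_mem (u : Fin (m + 1) → V) : gramPoly u ∈
    Algebra.adjoin ℚ (Set.range fun x : V × V => distPoly (m + 1) x.1 x.2) := by
  have h : ∀ a b : V, distPoly (m + 1) a b ∈
      Algebra.adjoin ℚ (Set.range fun x : V × V => distPoly (m + 1) x.1 x.2) :=
    fun a b => Algebra.subset_adjoin ⟨(a, b), rfl⟩
  rw [gramPoly, det_apply]
  refine Subalgebra.sum_mem _ fun s _ =>
    Subalgebra.zsmul_mem _ (Subalgebra.prod_mem _ fun i _ => ?_) _
  exact Subalgebra.mul_mem _ (Subalgebra.algebraMap_mem _ _)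
    (Subalgebra.sub_mem _ (Subalgebra.add_mem _ (h _ _) (h _ _)) (h _ _))

theorem gramPoly_ne_zero {u : Fin (m + 1) → V} (hu : Function.Injective u) : gramPoly u ≠ 0 := by
  intro h0
  -- The vertices `u i` are placed at the origin and at standard basis vectors.
  let q : V → Fin (m + 1) → ℂ := Function.extend u (Fin.cons 0 fun j => Pi.single j.succ 1) 0
  have hq : frameMatrix u q * (frameMatrix u q)ᵀ = 1 := by
    ext i j
    change (q (u i.succ) - q (u 0)) ⬝ᵥ (q (u j.succ) - q (u 0)) = _
    simp [q, hu.extend_apply, one_apply, Pi.single_apply, eq_comm]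
  have := evalAt_gramPoly u q
  rw [h0, hq, map_zero, det_one] at this
  exact zero_ne_one this

theorem IsMinimallyRigid.gram_det_ne_zero [Finite V] (hG : IsMinimallyRigid (m + 1) G)
    {u : Fin (m + 1) → V} (hu : Function.Injective u) {p q : V → Fin (m + 1) → ℂ}
    (hp : IsGeneric p) (hq : Equivalent G p q) :
    (frameMatrix u q * (frameMatrix u q)ᵀ).det ≠ 0 := by
  rw [← evalAt_gramPoly]
  exact fun h => gramPoly_ne_zero hu (hG.eq_zero_of_evalAt_eq_zero hp hq (gramPoly_mem u) h)

end

/-! ### Finiteness of the number of realizations -/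

section
variable {V : Type*} {d : ℕ} {G : SimpleGraph V}

theorem sqNorm_mulVec {A : Matrix (Fin d) (Fin d) ℂ} (hA : Aᵀ * A = 1) (x : Fin d → ℂ) :
    sqNorm (A *ᵥ x) = sqNorm x := by
  rw [sqNorm_eq_dotProduct, sqNorm_eq_dotProduct, dotProduct_mulVec, vecMul_mulVec, hA, vecMul_one]

theorem sqNorm_isometry {A : Matrix (Fin d) (Fin d) ℂ} (hA : Aᵀ * A = 1) (b x y : Fin d → ℂ) :
    sqNorm ((A *ᵥ x + b) - (A *ᵥ y + b)) = sqNorm (x - y) := by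
  rw [add_sub_add_right_eq_sub, ← mulVec_sub, sqNorm_mulVec hA]

theorem Equivalent.isometry {p q : V → Fin d → ℂ} (h : Equivalent G p q)
    {A : Matrix (Fin d) (Fin d) ℂ} (hA : Aᵀ * A = 1) (b : Fin d → ℂ) :
    Equivalent G p fun v => A *ᵥ q v + b := fun u v huv => by
  rw [sqNorm_isometry hA]
  exact h u v huv

theorem Equivalent.refl (p : V → Fin d → ℂ) : Equivalent G p p := fun _ _ _ => rfl

instance (p : V → Fin d → ℂ) : Nonempty (Quotient (congruenceSetoid G p)) :=
  ⟨Quotient.mk _ ⟨p, .refl p⟩⟩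

/-- A reflection in a coordinate hyperplane. -/
def reflection (m : ℕ) : Matrix (Fin (m + 1)) (Fin (m + 1)) ℂ :=
  diagonal (Fin.cons (-1) 1)

theorem reflection_mul_self (m : ℕ) : reflection m * reflection m = 1 := by
  rw [reflection, diagonal_mul_diagonal, ← diagonal_one]
  congr 1
  ext i
  refine Fin.cases ?_ (fun j => ?_) i <;> simp

theorem reflection_transpose_mul (m : ℕ) : (reflection m)ᵀ * reflection m = 1 := by
  rw [reflection, diagonal_transpose]
  exact reflection_mul_self m

theorem reflection_det (m : ℕ) : (reflection m).det = -1 := by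
  rw [reflection, det_diagonal, Fin.prod_univ_succ]
  simp

theorem det_eq_one_or {n : Type*} [Fintype n] [DecidableEq n] {A : Matrix n n ℂ}
    (hA : Aᵀ * A = 1) : A.det = 1 ∨ A.det = -1 := by
  have := congrArg Matrix.det hA
  rw [det_mul, det_transpose, det_one] at this
  exact mul_self_eq_one_iff.mp this

end

/-- A generic realization of a minimally rigid graph has finitely many equivalent realizations up to
direct isometries: there are finitely many possible distance matrices, and each is realized by at
most two classes, mirror images of each other. -/
theorem IsMinimallyRigid.finite_quotient {V : Type*} [Finite V] {m : ℕ} {G : SimpleGraph V}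
    (hG : IsMinimallyRigid (m + 1) G) {u : Fin (m + 1) → V} (hu : Function.Injective u)
    {p : V → Fin (m + 1) → ℂ} (hp : IsGeneric p) :
    Finite (Quotient (congruenceSetoid G p)) := by
  let D : (V → Fin (m + 1) → ℂ) → V × V → ℂ := fun q x => evalAt q (distPoly _ x.1 x.2)
  -- The distance matrices of the realizations equivalent to `p`.
  let Δ : Set (V × V → ℂ) := {c | ∃ q, Equivalent G p q ∧ D q = c}
  have hΔ : Δ.Finite := by
    have hfin : ∀ x : V × V, _ := fun x => finite_values_of_isAlgebraic (evalAt p)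
      (fun t _ h => (map_eq_zero_iff _ hp.evalAt_injective).mp h)
      (hG.isAlgebraic_distPoly x.1 x.2)
    refine (Set.Finite.pi' hfin).subset ?_
    rintro c ⟨q, hq, rfl⟩ x
    refine ⟨evalAt q, eq_on_adjoin ?_, rfl⟩
    rintro _ ⟨e, rfl⟩
    exact equivalent_iff.mp hq e e.2
  have := hΔ.to_subtype
  choose q hq hqD using fun c : Δ => c.2
  let f : Δ × Bool → Quotient (congruenceSetoid G p) := fun x =>
    if x.2 then Quotient.mk _ ⟨q x.1, hq x.1⟩
    else Quotient.mk _ ⟨_, (hq x.1).isometry (reflection_transpose_mul m) 0⟩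
  refine Finite.of_surjective f fun c => ?_
  induction c using Quotient.inductionOn with
  | _ r =>
    let δ : Δ := ⟨D r.1, r.1, r.2, rfl⟩
    have hdist : ∀ v w, sqNorm (r.1 v - r.1 w) = sqNorm (q δ v - q δ w) := fun v w => by
      have := congrFun (hqD δ) (v, w)
      change evalAt (q δ) (distPoly _ v w) = evalAt r.1 (distPoly _ v w) at this
      rw [evalAt_distPoly_complex, evalAt_distPoly_complex] at this
      exact this.symm
    obtain ⟨A, b, hA, hAb⟩ := exists_congruence hdist u (hG.gram_det_ne_zero hu hp (hq δ))
    -- An indirect isometry becomes direct after composition with a reflection.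
    rcases det_eq_one_or hA with h1 | h1
    · exact ⟨(δ, true), Quotient.sound ⟨A, b, hA, h1, hAb⟩⟩
    · refine ⟨(δ, false), Quotient.sound ⟨A * reflection m, b, ?_, ?_, fun v => ?_⟩⟩
      · rw [transpose_mul, Matrix.mul_assoc, ← Matrix.mul_assoc Aᵀ, hA, Matrix.one_mul,
          reflection_transpose_mul]
      · rw [det_mul, h1, reflection_det]
        norm_num
      · rw [hAb v]
        simp only [add_zero]
        rw [mulVec_mulVec, Matrix.mul_assoc, reflection_mul_self, Matrix.mul_one]

/-! ### Field automorphisms acting on realizations -/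

section
variable {V : Type*} {d : ℕ} {G : SimpleGraph V}

theorem sqNorm_map (σ : ℂ ≃+* ℂ) (x : Fin d → ℂ) : sqNorm (σ ∘ x) = σ (sqNorm x) := by
  simp [sqNorm]

theorem map_comp_sub (σ : ℂ ≃+* ℂ) (x y : Fin d → ℂ) : σ ∘ x - σ ∘ y = σ ∘ (x - y) := by
  ext i
  simp

theorem sqNorm_map_sub (σ : ℂ ≃+* ℂ) (x y : Fin d → ℂ) :
    sqNorm (σ ∘ x - σ ∘ y) = σ (sqNorm (x - y)) := by
  rw [map_comp_sub, sqNorm_map]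

theorem DirectlyCongruent.map {p q : V → Fin d → ℂ} (h : DirectlyCongruent p q) (σ : ℂ ≃+* ℂ) :
    DirectlyCongruent (fun v => σ ∘ p v) (fun v => σ ∘ q v) := by
  obtain ⟨A, b, hA, hdet, h⟩ := h
  refine ⟨A.map σ, σ ∘ b, ?_, ?_, fun v => ?_⟩
  · rw [← transpose_map, ← Matrix.map_mul, hA, Matrix.map_one _ (map_zero σ) (map_one σ)]
  · have := RingHom.map_det (σ : ℂ →+* ℂ) A
    rw [hdet, map_one] at this
    exact this.symm
  · change σ ∘ q v = A.map σ *ᵥ (σ ∘ p v) + σ ∘ b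
    rw [h v]
    ext i
    simp [mulVec, dotProduct]

theorem Equivalent.map {p q : V → Fin d → ℂ} (h : Equivalent G p q) (σ : ℂ ≃+* ℂ) :
    Equivalent G (fun v => σ ∘ p v) (fun v => σ ∘ q v) := fun u v huv => by
  simp only [sqNorm_map_sub, h u v huv]

theorem numRealizations_le_map (σ : ℂ ≃+* ℂ) (p : V → Fin d → ℂ) :
    numRealizations G p ≤ numRealizations G (fun v => σ ∘ p v) := by
  have hσ : ∀ q : V → Fin d → ℂ, (fun v => σ.symm ∘ (σ ∘ q v)) = q := fun q => by
    ext v i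
    simp
  let f : Quotient (congruenceSetoid G p) →
      Quotient (congruenceSetoid G (fun v => σ ∘ p v)) :=
    Quotient.map (fun q => ⟨fun v => σ ∘ q.1 v, q.2.map σ⟩) fun _ _ h => h.map σ
  refine ENat.card_le_card_of_injective (f := f) ?_
  intro x y
  induction x, y using Quotient.inductionOn₂ with
  | _ x y =>
    intro h
    have h' : DirectlyCongruent (fun v => σ ∘ x.1 v) (fun v => σ ∘ y.1 v) := Quotient.exact h
    have := h'.map σ.symm
    rw [hσ, hσ] at this
    exact Quotient.sound this

theorem numRealizations_map (σ : ℂ ≃+* ℂ) (p : V → Fin d → ℂ) :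
    numRealizations G (fun v => σ ∘ p v) = numRealizations G p := by
  refine le_antisymm ((numRealizations_le_map σ.symm _).trans_eq ?_) (numRealizations_le_map σ p)
  congr 1
  ext v i
  simp

/-- The number of realizations does not depend on the generic realization, since any two of these
are conjugate under an automorphism of `ℂ`. -/
theorem IsGeneric.numRealizations_eq [Finite V] {p p' : V → Fin d → ℂ} (hp : IsGeneric p)
    (hp' : IsGeneric p') : numRealizations G p = numRealizations G p' := by
  have := countable_mvPolynomial (V × Fin d)
  obtain ⟨σ, hσ⟩ := exists_ringEquiv_comp_eq (evalAt p : MvPolynomial (V × Fin d) ℚ →+* ℂ)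
    (evalAt p' : MvPolynomial (V × Fin d) ℚ →+* ℂ)
    hp.evalAt_injective hp'.evalAt_injective
  rw [← numRealizations_map σ p]
  congr 1
  ext v i
  simpa [evalAt] using hσ (MvPolynomial.X (v, i))

end

/-! ### Fibering realizations over their restrictions -/

section
variable {T U : Type*} {d : ℕ}

/-- The realizations equivalent to `p` whose restriction along `ι` is `r`. -/
abbrev Extension (Γ : SimpleGraph T) (ι : U → T) (p : T → Fin d → ℂ) (r : U → Fin d → ℂ) : Type _ :=
  {q : T → Fin d → ℂ // Equivalent Γ p q ∧ ∀ x, q (ι x) = r x}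

/-- If all realizations `r` of `H` have trivial stabilizer and extension sets of the same size, then
classes of realizations of `Γ` correspond to pairs of a class for `H` and an extension. -/
theorem nonempty_quotient_equiv_prod {Γ : SimpleGraph T} {H : SimpleGraph U} {ι : U → T}
    (hι : ∀ a b, H.Adj a b → Γ.Adj (ι a) (ι b)) {p : T → Fin d → ℂ}
    (hstab : ∀ r, Equivalent H (p ∘ ι) r → ∀ (A : Matrix (Fin d) (Fin d) ℂ) (b : Fin d → ℂ),
      Aᵀ * A = 1 → A.det = 1 → (∀ v, r v = A *ᵥ r v + b) → A = 1 ∧ b = 0)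
    {X : Type*} (hX : ∀ r, Equivalent H (p ∘ ι) r → Nonempty (Extension Γ ι p r ≃ X)) :
    Nonempty (Quotient (congruenceSetoid Γ p) ≃
      Quotient (congruenceSetoid H (p ∘ ι)) × X) := by
  -- Each class downstairs is represented by a fixed realization, which is then extended.
  let f : (Σ c : Quotient (congruenceSetoid H (p ∘ ι)), Extension Γ ι p c.out.1) →
      Quotient (congruenceSetoid Γ p) := fun x => Quotient.mk _ ⟨x.2.1, x.2.2.1⟩
  have hf : Function.Bijective f := by
    constructor
    · rintro ⟨c, q, hq, hqc⟩ ⟨c', q', hq', hqc'⟩ h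
      obtain ⟨A, b, hA, hdet, hAb⟩ : DirectlyCongruent q q' := Quotient.exact h
      have hcc : c = c' := by
        rw [← Quotient.out_eq c, ← Quotient.out_eq c']
        refine Quotient.sound ⟨A, b, hA, hdet, fun x => ?_⟩
        rw [← hqc, ← hqc']
        exact hAb _
      subst hcc
      obtain ⟨rfl, rfl⟩ := hstab _ c.out.2 A b hA hdet fun x => by
        rw [← hqc, ← hAb, hqc, hqc']
      have : q = q' := funext fun v => by simp [hAb v]
      subst this
      rfl
    · intro x
      induction x using Quotient.inductionOn with
      | _ q =>
        have hr : Equivalent H (p ∘ ι) (q.1 ∘ ι) := fun a b hab => q.2 _ _ (hι a b hab)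
        obtain ⟨A, b, hA, hdet, h⟩ :=
          (congruenceSetoid H (p ∘ ι)).symm (Quotient.mk_out (s := congruenceSetoid H (p ∘ ι))
            ⟨q.1 ∘ ι, hr⟩)
        refine ⟨⟨Quotient.mk _ ⟨q.1 ∘ ι, hr⟩, fun v => A *ᵥ q.1 v + b, q.2.isometry hA b,
          fun x => (h x).symm⟩, ?_⟩
        have : congruenceSetoid Γ p q ⟨fun v => A *ᵥ q.1 v + b, q.2.isometry hA b⟩ :=
          ⟨A, b, hA, hdet, fun _ => rfl⟩
        exact (Quotient.sound this).symm
  exact ⟨(Equiv.ofBijective f hf).symm.trans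
    ((Equiv.sigmaCongrRight fun c => (hX _ c.out.2).some).trans (Equiv.sigmaEquivProd _ _))⟩

end

/-! ### The number of extensions of a realization -/

theorem isAlgebraic_map_of_injective {k R S : Type*} [CommRing k] [CommRing R] [CommRing S]
    [Algebra k R] [Algebra k S] {ρ : R →ₐ[k] S} (hρ : Function.Injective ρ) {T : Subalgebra k R}
    {T' : Subalgebra k S} (hT : ∀ t ∈ T, ρ t ∈ T') {x : R} (hx : IsAlgebraic T x) :
    IsAlgebraic T' (ρ x) := by
  obtain ⟨P, hP0, hP⟩ := hx
  let f : T →ₐ[k] T' := (ρ.comp T.val).codRestrict T' fun t => hT t t.2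
  have hf : Function.Injective f := fun a b hab =>
    Subtype.ext (hρ (congrArg Subtype.val hab))
  refine ⟨P.map (f : T →+* T'), (Polynomial.map_ne_zero_iff hf).mpr hP0, ?_⟩
  have h := congrArg (ρ : R →+* S) hP
  rw [Polynomial.aeval_def, Polynomial.hom_eval₂, map_zero] at h
  rw [Polynomial.aeval_def, Polynomial.eval₂_map]
  exact h

section
variable {V : Type*} {d : ℕ} {G : SimpleGraph V} {H : G.Subgraph}

theorem evalAt_edgePoly_map {U : Type*} (ι : U → V) {K : Type*} [Field K] [Algebra ℚ K]
    (p : V → Fin d → K) (e : Sym2 U) :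
    evalAt p (edgePoly d (e.map ι)) = evalAt (p ∘ ι) (edgePoly d e) := by
  induction e with
  | _ a b => simp [evalAt_distPoly]

theorem IsGeneric.comp {U : Type*} {ι : U → V} (hι : Function.Injective ι) {K : Type*} [Field K]
    [Algebra ℚ K] {p : V → Fin d → K} (hp : IsGeneric p) : IsGeneric (p ∘ ι) :=
  AlgebraicIndependent.comp hp (Prod.map ι id) (hι.prodMap Function.injective_id)

/-- The edges of `G` outside `H`. -/
abbrev OuterEdge (H : G.Subgraph) : Type _ := {e : G.edgeSet // (e : Sym2 V) ∉ H.edgeSet}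

/-- Evaluation at the realization `r` of `H` and at the squared lengths, in the realization `p`, of
the edges outside `H`. The outer edge lengths are independent variables here because `r` need not
extend to a realization with these lengths. -/
noncomputable def evalPair (r : H.verts → Fin d → ℂ) (p : V → Fin d → ℂ) :
    MvPolynomial ((H.verts × Fin d) ⊕ OuterEdge H) ℚ →ₐ[ℚ] ℂ :=
  MvPolynomial.aeval (Sum.elim (fun x => r x.1 x.2) fun e => evalAt p (edgePoly d (e : Sym2 V)))

theorem evalPair_rename (r : H.verts → Fin d → ℂ) (p : V → Fin d → ℂ)
    (f : MvPolynomial (H.verts × Fin d) ℚ) :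
    evalPair r p (MvPolynomial.rename Sum.inl f) = evalAt r f := by
  rw [evalPair, MvPolynomial.aeval_rename]
  rfl

theorem evalPair_X (r : H.verts → Fin d → ℂ) (p : V → Fin d → ℂ) (e : OuterEdge H) :
    evalPair r p (MvPolynomial.X (Sum.inr e)) = evalAt p (edgePoly d (e : Sym2 V)) := by
  simp [evalPair]

theorem mem_edgeSet_iff_exists_coe {e : Sym2 V} :
    e ∈ H.edgeSet ↔ ∃ e' ∈ H.coe.edgeSet, e'.map Subtype.val = e := by
  rw [← SimpleGraph.Subgraph.image_coe_edgeSet_coe]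
  rfl

/-- The squared lengths of all edges: those in `H` as polynomials in the coordinates, those outside
`H` as variables. -/
noncomputable def pairEdgePoly (d : ℕ) (H : G.Subgraph) : H.coe.edgeSet ⊕ OuterEdge H →
    MvPolynomial ((H.verts × Fin d) ⊕ OuterEdge H) ℚ :=
  Sum.elim (fun e => MvPolynomial.rename Sum.inl (edgePoly d (e : Sym2 H.verts)))
    fun e => MvPolynomial.X (Sum.inr e)

/-- The algebra generated by all squared distances between vertices of `H` and by the squared
lengths of the edges outside `H`. -/
noncomputable def pairAlgebra (d : ℕ) (H : G.Subgraph) :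
    Subalgebra ℚ (MvPolynomial ((H.verts × Fin d) ⊕ OuterEdge H) ℚ) :=
  Algebra.adjoin ℚ (Set.range (fun x : H.verts × H.verts =>
    MvPolynomial.rename Sum.inl (distPoly d x.1 x.2)) ∪
      Set.range fun e => MvPolynomial.X (Sum.inr e))

theorem isAlgebraic_of_mem_pairAlgebra [Finite V] (hH : IsMinimallyRigid d H.coe)
    {f : MvPolynomial ((H.verts × Fin d) ⊕ OuterEdge H) ℚ} (hf : f ∈ pairAlgebra d H) :
    IsAlgebraic (Algebra.adjoin ℚ (Set.range (pairEdgePoly d H))) f := by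
  induction hf using Algebra.adjoin_induction with
  | mem x hx =>
    rcases hx with ⟨⟨a, b⟩, rfl⟩ | ⟨e, rfl⟩
    · refine isAlgebraic_map_of_injective (MvPolynomial.rename_injective _ Sum.inl_injective)
        (fun t ht => ?_) (hH.isAlgebraic_distPoly a b)
      have := (Subalgebra.mem_map (f := MvPolynomial.rename (R := ℚ)
        (Sum.inl : _ → (H.verts × Fin d) ⊕ OuterEdge H))).mpr ⟨t, ht, rfl⟩
      rw [AlgHom.map_adjoin] at this
      refine Algebra.adjoin_mono ?_ this
      rintro _ ⟨_, ⟨e, rfl⟩, rfl⟩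
      exact ⟨Sum.inl e, rfl⟩
    · exact isAlgebraic_algebraMap (⟨_, Algebra.subset_adjoin ⟨Sum.inr e, rfl⟩⟩ :
        Algebra.adjoin ℚ (Set.range (pairEdgePoly d H)))
  | algebraMap r => exact isAlgebraic_algebraMap (algebraMap ℚ (Algebra.adjoin ℚ _) r)
  | add x y _ _ hx hy => exact hx.add hy
  | mul x y _ _ hx hy => exact hx.mul hy

/-- Evaluation is injective on `pairAlgebra`: the latter is algebraic over the edge lengths, whose
values are those at the generic `p` and thus algebraically independent. -/
theorem evalPair_injective [Finite V] (hG : IsMinimallyRigid d G) (hH : IsMinimallyRigid d H.coe)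
    {p : V → Fin d → ℂ} (hp : IsGeneric p) {r : H.verts → Fin d → ℂ}
    (hr : Equivalent H.coe (p ∘ Subtype.val) r) {f} (hf : f ∈ pairAlgebra d H)
    (h0 : evalPair r p f = 0) : f = 0 := by
  refine eq_zero_of_map_eq_zero_of_algebraicIndependent (evalPair r p) ?_
    (isAlgebraic_of_mem_pairAlgebra hH hf) h0
  have hmem : ∀ e : H.coe.edgeSet, (e : Sym2 H.verts).map Subtype.val ∈ H.edgeSet :=
    fun e => mem_edgeSet_iff_exists_coe.mpr ⟨e, e.2, rfl⟩
  let j : H.coe.edgeSet ⊕ OuterEdge H → G.edgeSet :=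
    Sum.elim (fun e => ⟨_, H.edgeSet_subset (hmem e)⟩) fun e => e.1
  have hj : Function.Injective j := by
    rintro (a | a) (b | b) hab
    · have := congrArg Subtype.val hab
      exact congrArg Sum.inl (Subtype.ext (Sym2.map.injective Subtype.val_injective this))
    · exact (b.2 (congrArg Subtype.val hab ▸ hmem a)).elim
    · exact (a.2 (congrArg Subtype.val hab.symm ▸ hmem b)).elim
    · exact congrArg Sum.inr (Subtype.ext hab)
  have h := (hG.algebraicIndependent.map' (f := evalAt p) hp.evalAt_injective).comp j hj
  have heq : evalPair r p ∘ pairEdgePoly d H =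
      (evalAt p ∘ fun e : G.edgeSet => edgePoly d (e : Sym2 V)) ∘ j := by
    ext (e | e)
    · change evalPair r p (MvPolynomial.rename Sum.inl _) = evalAt p (edgePoly d (Sym2.map _ _))
      rw [evalPair_rename, evalAt_edgePoly_map]
      exact equivalent_iff.mp hr e e.2
    · exact evalPair_X r p e
  rw [heq]
  exact h

/-- Any two realizations of `H` equivalent to restrictions of generic realizations of `G` have
distances that are conjugate under an automorphism of `ℂ` compatible with all edge lengths of
`G`. -/
theorem exists_ringEquiv_of_equivalent [Finite V] (hG : IsMinimallyRigid d G)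
    (hH : IsMinimallyRigid d H.coe) {p p' : V → Fin d → ℂ} (hp : IsGeneric p) (hp' : IsGeneric p')
    {r r' : H.verts → Fin d → ℂ} (hr : Equivalent H.coe (p ∘ Subtype.val) r)
    (hr' : Equivalent H.coe (p' ∘ Subtype.val) r') :
    ∃ σ : ℂ ≃+* ℂ, (∀ a b, σ (sqNorm (r a - r b)) = sqNorm (r' a - r' b)) ∧
      ∀ u v, G.Adj u v → σ (sqNorm (p u - p v)) = sqNorm (p' u - p' v) := by
  have := countable_mvPolynomial ((H.verts × Fin d) ⊕ OuterEdge H)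
  obtain ⟨σ, hσ⟩ := exists_ringEquiv_comp_eq
    ((evalPair r p).comp (pairAlgebra d H).val : pairAlgebra d H →+* ℂ)
    ((evalPair r' p').comp (pairAlgebra d H).val : pairAlgebra d H →+* ℂ)
    ((injective_iff_map_eq_zero _).mpr fun f hf =>
      Subtype.ext (evalPair_injective hG hH hp hr f.2 hf))
    ((injective_iff_map_eq_zero _).mpr fun f hf =>
      Subtype.ext (evalPair_injective hG hH hp' hr' f.2 hf))
  replace hσ : ∀ f ∈ pairAlgebra d H, σ (evalPair r p f) = evalPair r' p' f :=
    fun f hf => hσ ⟨f, hf⟩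
  have h1 : ∀ a b, σ (sqNorm (r a - r b)) = sqNorm (r' a - r' b) := fun a b => by
    have := hσ _ (Algebra.subset_adjoin (Or.inl ⟨(a, b), rfl⟩))
    rwa [evalPair_rename, evalPair_rename, evalAt_distPoly_complex,
      evalAt_distPoly_complex] at this
  refine ⟨σ, h1, fun u v huv => ?_⟩
  by_cases he : H.Adj u v
  · have h2 : sqNorm (r ⟨u, H.edge_vert he⟩ - r ⟨v, H.edge_vert he.symm⟩) = sqNorm (p u - p v) :=
      hr _ _ he
    have h3 : sqNorm (r' ⟨u, H.edge_vert he⟩ - r' ⟨v, H.edge_vert he.symm⟩) =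
      sqNorm (p' u - p' v) := hr' _ _ he
    rw [← h2, ← h3, h1]
  · have := hσ _ (Algebra.subset_adjoin (Or.inr ⟨⟨⟨s(u, v), huv⟩, he⟩, rfl⟩))
    rwa [evalPair_X, evalPair_X, edgePoly_mk, evalAt_distPoly_complex,
      evalAt_distPoly_complex] at this

end

section
variable {V : Type*} {m : ℕ} {G : SimpleGraph V} {H : G.Subgraph}

/-- Conjugate an extension of `r` by the automorphism of `exists_ringEquiv_of_equivalent`, and move
its restriction to `r'` by an isometry. -/
theorem exists_extension_embedding [Finite V] (hG : IsMinimallyRigid (m + 1) G)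
    (hH : IsMinimallyRigid (m + 1) H.coe) {u : Fin (m + 1) → H.verts} (hu : Function.Injective u)
    {p p' : V → Fin (m + 1) → ℂ} (hp : IsGeneric p) (hp' : IsGeneric p')
    {r r' : H.verts → Fin (m + 1) → ℂ} (hr : Equivalent H.coe (p ∘ Subtype.val) r)
    (hr' : Equivalent H.coe (p' ∘ Subtype.val) r') :
    Nonempty (Extension G Subtype.val p r ↪ Extension G Subtype.val p' r') := by
  obtain ⟨σ, hσ, hσ'⟩ := exists_ringEquiv_of_equivalent hG hH hp hp' hr hr'
  obtain ⟨A, b, hA, hAb⟩ := exists_congruence (p := r') (q := fun v => σ ∘ r v)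
    (fun v w => by rw [sqNorm_map_sub, hσ]) u
    (hH.gram_det_ne_zero hu (hp'.comp Subtype.val_injective) hr')
  have hA' : Aᵀᵀ * Aᵀ = 1 := by
    rw [transpose_transpose]
    exact mul_eq_one_comm.mp hA
  refine ⟨⟨fun q => ⟨fun v => Aᵀ *ᵥ (σ ∘ q.1 v) + Aᵀ *ᵥ (-b), fun v w hvw => ?_, fun x => ?_⟩,
    fun q q' hqq => Subtype.ext (funext fun v => ?_)⟩⟩
  · rw [sqNorm_isometry hA', sqNorm_map_sub, q.2.1 v w hvw, hσ' v w hvw]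
  · have h : σ ∘ q.1 x = A *ᵥ r' x + b := by rw [q.2.2, hAb]
    change Aᵀ *ᵥ (σ ∘ q.1 x) + Aᵀ *ᵥ (-b) = r' x
    rw [h, ← mulVec_add, add_neg_cancel_right, mulVec_mulVec, hA, one_mulVec]
  · have h := congrFun (congrArg Subtype.val hqq) v
    have h1 : Aᵀ *ᵥ (σ ∘ q.1 v) = Aᵀ *ᵥ (σ ∘ q'.1 v) := add_right_cancel h
    have h2 := congrArg (A *ᵥ ·) h1
    simp only [mulVec_mulVec, mul_eq_one_comm.mp hA, one_mulVec] at h2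
    exact funext fun i => σ.injective (congrFun h2 i)

/-- The number of extensions to `G` is the same for all realizations of `H` equivalent to the
restriction of a generic one, whichever generic lengths are prescribed. -/
theorem nonempty_extension_equiv [Finite V] (hG : IsMinimallyRigid (m + 1) G)
    (hH : IsMinimallyRigid (m + 1) H.coe) {u : Fin (m + 1) → H.verts} (hu : Function.Injective u)
    {p p' : V → Fin (m + 1) → ℂ} (hp : IsGeneric p) (hp' : IsGeneric p')
    {r r' : H.verts → Fin (m + 1) → ℂ} (hr : Equivalent H.coe (p ∘ Subtype.val) r)
    (hr' : Equivalent H.coe (p' ∘ Subtype.val) r') :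
    Nonempty (Extension G Subtype.val p r ≃ Extension G Subtype.val p' r') := by
  obtain ⟨f⟩ := exists_extension_embedding hG hH hu hp hp' hr hr'
  obtain ⟨g⟩ := exists_extension_embedding hG hH hu hp' hp hr' hr
  exact f.antisymm g

end

/-! ### Realizations of the glued graph -/

section
variable {V : Type*} {d : ℕ} {G' : SimpleGraph V} {H : G'.Subgraph} {k : ℕ}

theorem copyMap_coe (j : Fin k) (x : H.verts) : copyMap H k j x = Sum.inl x :=
  dif_pos x.2

theorem copyMap_of_notMem (j : Fin k) (x : (H.vertsᶜ : Set V)) :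
    copyMap H k j x = Sum.inr (j, x) :=
  dif_neg x.2

theorem copyMap_injective (j : Fin k) : Function.Injective (copyMap H k j) := by
  intro v w h
  unfold copyMap at h
  split_ifs at h <;> simp_all

theorem fan_adj_inl {a b : H.verts} (h : H.coe.Adj a b) :
    (fan G' H k).Adj (Sum.inl a) (Sum.inl b) :=
  Or.inl (SimpleGraph.map_adj_apply' h fun he => h.ne (Sum.inl_injective he))

theorem fan_adj_copyMap (j : Fin k) {a b : V} (h : G'.Adj a b) :
    (fan G' H k).Adj (copyMap H k j a) (copyMap H k j b) :=
  Or.inr (SimpleGraph.iSup_adj.mpr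
    ⟨j, SimpleGraph.map_adj_apply' h fun he => h.ne (copyMap_injective j he)⟩)

theorem equivalent_fan_iff {p q : FanVertex H k → Fin d → ℂ} : Equivalent (fan G' H k) p q ↔
    Equivalent H.coe (p ∘ Sum.inl) (q ∘ Sum.inl) ∧
      ∀ j, Equivalent G' (p ∘ copyMap H k j) (q ∘ copyMap H k j) := by
  constructor
  · exact fun h => ⟨fun a b hab => h _ _ (fan_adj_inl hab),
      fun j a b hab => h _ _ (fan_adj_copyMap j hab)⟩
  · rintro ⟨h1, h2⟩ a b hab
    rw [fan, SimpleGraph.sup_adj, SimpleGraph.iSup_adj] at hab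
    rcases hab with ⟨-, a, b, hab, rfl, rfl⟩ | ⟨j, -, a, b, hab, rfl, rfl⟩
    · exact h1 a b hab
    · exact h2 j a b hab

/-- Extending a realization of `H` to the glued graph means extending it to each copy separately. -/
noncomputable def fanExtensionEquiv {p : FanVertex H k → Fin d → ℂ} {r : H.verts → Fin d → ℂ}
    (hr : Equivalent H.coe (p ∘ Sum.inl) r) :
    Extension (fan G' H k) Sum.inl p r ≃
      ∀ j, Extension G' Subtype.val (p ∘ copyMap H k j) r where
  toFun q j := ⟨q.1 ∘ copyMap H k j, (equivalent_fan_iff.mp q.2.1).2 j, fun x => by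
    rw [Function.comp_apply, copyMap_coe, q.2.2]⟩
  invFun q := ⟨Sum.elim r fun x => (q x.1).1 x.2, by
    have hcopy : ∀ j, (Sum.elim r fun x => (q x.1).1 x.2) ∘ copyMap H k j = (q j).1 := by
      intro j
      ext1 v
      by_cases hv : v ∈ H.verts
      · rw [Function.comp_apply, copyMap_coe j ⟨v, hv⟩]
        exact ((q j).2.2 ⟨v, hv⟩).symm
      · rw [Function.comp_apply, copyMap_of_notMem j ⟨v, hv⟩]
        rfl
    refine ⟨equivalent_fan_iff.mpr ⟨hr, fun j => ?_⟩, fun _ => rfl⟩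
    rw [hcopy]
    exact (q j).2.1⟩
  left_inv q := by
    refine Subtype.ext (funext fun v => ?_)
    rcases v with x | ⟨j, x⟩
    · exact (q.2.2 x).symm
    · change q.1 (copyMap H k j x) = _
      rw [copyMap_of_notMem]
  right_inv q := by
    funext j
    refine Subtype.ext (funext fun v => ?_)
    change (Sum.elim r fun x => (q x.1).1 x.2) (copyMap H k j v) = _
    by_cases hv : v ∈ H.verts
    · rw [copyMap_coe j ⟨v, hv⟩]
      exact ((q j).2.2 ⟨v, hv⟩).symm
    · rw [copyMap_of_notMem j ⟨v, hv⟩]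
      rfl

end

/-! ### The realization counts -/

/-- In dimension zero there is only one realization. -/
theorem isRealizationCount_zero {V : Type*} (G : SimpleGraph V) : IsRealizationCount 0 G 1 := by
  intro p _
  have : Subsingleton (Quotient (congruenceSetoid G p)) := by
    refine ⟨fun x y => ?_⟩
    induction x, y using Quotient.inductionOn₂ with
    | _ x y => rw [Subsingleton.elim x y]
  have : Unique (Quotient (congruenceSetoid G p)) :=
    uniqueOfSubsingleton (Quotient.mk _ ⟨p, .refl p⟩)
  rw [numRealizations, ENat.card_eq_coe_natCard, Nat.card_unique]

/-- In positive dimension, each class of realizations of `H` extends in the same number `N` of ways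
to `G'`, and in `N ^ k` ways to the glued graph. -/
theorem isRealizationCount_fan [Finite V] {m : ℕ} {G' : SimpleGraph V} {H : G'.Subgraph}
    (hG' : IsMinimallyRigid (m + 1) G') (hH : IsMinimallyRigid (m + 1) H.coe)
    (hd : m + 1 ≤ H.verts.ncard) :
    ∃ M N : ℕ, 0 < M ∧ IsRealizationCount (m + 1) H.coe M ∧
      IsRealizationCount (m + 1) G' (M * N) ∧
      ∀ k, IsRealizationCount (m + 1) (fan G' H k) (M * N ^ k) := by
  obtain ⟨u⟩ : Nonempty (Fin (m + 1) ↪ H.verts) := by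
    have := Fintype.ofFinite H.verts
    refine Function.Embedding.nonempty_of_card_le ?_
    rwa [Fintype.card_fin, ← Nat.card_eq_fintype_card]
  obtain ⟨p₀, hp₀⟩ := exists_isGeneric V (m + 1)
  have hres := hp₀.comp (Subtype.val_injective (p := (· ∈ H.verts)))
  have hfinH := hH.finite_quotient u.injective hres
  have hH0 : IsRealizationCount (m + 1) H.coe
      (Nat.card (Quotient (congruenceSetoid H.coe (p₀ ∘ Subtype.val)))) := by
    intro p hp
    rw [hp.numRealizations_eq hres, numRealizations, ENat.card_eq_coe_natCard]
  let X := Extension G' (Subtype.val : H.verts → V) p₀ (p₀ ∘ Subtype.val)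
  have hX : ∀ {p : V → Fin (m + 1) → ℂ}, IsGeneric p → ∀ r,
      Equivalent H.coe (p ∘ Subtype.val) r → Nonempty (Extension G' Subtype.val p r ≃ X) :=
    fun hp r hr => nonempty_extension_equiv hG' hH u.injective hp hp₀ hr (.refl _)
  have hstab : ∀ {p : H.verts → Fin (m + 1) → ℂ}, IsGeneric p → ∀ r, Equivalent H.coe p r →
      ∀ (A : Matrix (Fin (m + 1)) (Fin (m + 1)) ℂ) (b : Fin (m + 1) → ℂ),
      Aᵀ * A = 1 → A.det = 1 → (∀ v, r v = A *ᵥ r v + b) → A = 1 ∧ b = 0 :=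
    fun hp r hr A b hA hdet h =>
      eq_one_and_eq_zero_of_fixes u (hH.gram_det_ne_zero u.injective hp hr) hA hdet h
  have hequiv : ∀ {p : V → Fin (m + 1) → ℂ}, IsGeneric p →
      Nonempty (Quotient (congruenceSetoid G' p) ≃
        Quotient (congruenceSetoid H.coe (p ∘ Subtype.val)) × X) := fun hp =>
    nonempty_quotient_equiv_prod (fun a b h => H.adj_sub h)
      (hstab (hp.comp Subtype.val_injective)) (hX hp)
  -- Finiteness for `G'` bounds the number of extensions, since `H` has at least one class.
  have hfinX : Finite X := by
    have := hG'.finite_quotient (u := Subtype.val ∘ u)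
      (Subtype.val_injective.comp u.injective) hp₀
    obtain ⟨e⟩ := hequiv hp₀
    have := Finite.of_equiv _ e
    exact Finite.prod_right (Quotient (congruenceSetoid H.coe (p₀ ∘ Subtype.val)))
  have hcount : ∀ {p : H.verts → Fin (m + 1) → ℂ}, IsGeneric p →
      ENat.card (Quotient (congruenceSetoid H.coe p)) =
        Nat.card (Quotient (congruenceSetoid H.coe (p₀ ∘ Subtype.val))) := fun hp => hH0 _ hp
  refine ⟨_, Nat.card X, Nat.card_pos, hH0, fun p hp => ?_, fun k p hp => ?_⟩
  · obtain ⟨e⟩ := hequiv hp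
    rw [numRealizations, ENat.card_congr e, ENat.card_prod,
      hcount (hp.comp Subtype.val_injective), ENat.card_eq_coe_natCard X]
    push_cast
    rfl
  · have hinl : (Sum.inl : H.verts → FanVertex H k).Injective := Sum.inl_injective
    obtain ⟨e⟩ := nonempty_quotient_equiv_prod (Γ := fan G' H k) (H := H.coe) (p := p)
      (fun a b h => fan_adj_inl h) (hstab (hp.comp hinl)) (X := Fin k → X) fun r hr => by
        have hj : ∀ j : Fin k, Nonempty (Extension G' Subtype.val (p ∘ copyMap H k j) r ≃ X) := by
          intro j
          refine hX (hp.comp (copyMap_injective j)) r ?_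
          have : (p ∘ copyMap H k j) ∘ Subtype.val = p ∘ Sum.inl :=
            funext fun x => congrArg p (copyMap_coe j x)
          rwa [this]
        exact ⟨(fanExtensionEquiv hr).trans (Equiv.piCongrRight fun j => (hj j).some)⟩
    rw [numRealizations, ENat.card_congr e, ENat.card_prod, hcount (hp.comp hinl),
      ENat.card_eq_coe_natCard (Fin k → X), Nat.card_fun, Nat.card_fin]
    push_cast
    rfl

end RigidCount

theorem mainTheorem2 {V : Type*} [Finite V] (d k : ℕ) (G' : SimpleGraph V) (H : G'.Subgraph)
    (hG' : RigidCount.IsMinimallyRigid d G')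
    (hH : RigidCount.IsMinimallyRigid d H.coe)
    (hd : d ≤ H.verts.ncard) :
    RigidCount.IsRealizationCount d H.coe (RigidCount.realizationCount d H.coe) ∧
    RigidCount.IsRealizationCount d G' (RigidCount.realizationCount d G') ∧
    RigidCount.IsRealizationCount d (RigidCount.fan G' H k)
      (RigidCount.realizationCount d (RigidCount.fan G' H k)) ∧
    0 < RigidCount.realizationCount d H.coe ∧
    (RigidCount.realizationCount d (RigidCount.fan G' H k) : ℚ) =
      RigidCount.realizationCount d H.coe *
        ((RigidCount.realizationCount d G' : ℚ) / RigidCount.realizationCount d H.coe) ^ k := by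
  obtain ⟨M, N, hM, h1, h2, h3⟩ : ∃ M N : ℕ, 0 < M ∧ RigidCount.IsRealizationCount d H.coe M ∧
      RigidCount.IsRealizationCount d G' (M * N) ∧
      ∀ k, RigidCount.IsRealizationCount d (RigidCount.fan G' H k) (M * N ^ k) := by
    rcases d with _ | m
    · refine ⟨1, 1, one_pos, RigidCount.isRealizationCount_zero _,
        RigidCount.isRealizationCount_zero _, fun k => ?_⟩
      rw [one_pow]
      exact RigidCount.isRealizationCount_zero _
    · exact RigidCount.isRealizationCount_fan hG' hH hd
  rw [h1.realizationCount_eq, h2.realizationCount_eq, (h3 k).realizationCount_eq]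
  refine ⟨h1, h2, h3 k, hM, ?_⟩
  have : (M : ℚ) ≠ 0 := by exact_mod_cast hM.ne'
  push_cast
  rw [mul_div_cancel_left₀ _ this]
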